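/- Let $c:\mathbb R\to(0,\infty)$ be a non-constant $C^2$ function (the doping profile), and consider the Cauchy problem for the one-dimensional repulsive pressureless Euler--Poisson system $$V_t+VV_x=-E,\qquad E_t+VE_x=c(x)V\qquad(n=c(x)-E_x),\qquad (V,E)|_{t=0}=(V_0,E_0)\in C^2(\mathbb R),$$ whose equilibrium is $V=E=0$. A classical solution is a $C^1$ solution, and its characteristic from $x_0$ is the curve $\dot x=V(t,x)$, $x(0)=x_0$. Then every small smooth perturbation of the equilibrium that is present at a point where $c$ varies blows up in finite time. Precisely: there are points $x_0$ with $c'(x_0)\neq0$, and for each such $x_0$ there is $\varepsilon>0$, depending only on $c$ and $x_0$, such that for all $V_0,E_0\in C^2(\mathbb R)$ with $$0<\|(V_0(x_0),E_0(x_0))\|<\varepsilon$$ there is $T\in(0,\infty)$ with the following properties. 1. There is a classical solution in a (relatively open) neighbourhood in $\{t\ge0\}$ of the characteristic starting from $x_0$, $0\le t<T$, and for every such solution $|V_x|+|E_x|\to\infty$ along this characteristic as $t\to T^-$. 2. There is no classical solution on $[0,T')\times\mathbb R$ for any $T'>T$. -/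

import Mathlib

open Set Filter Topology

namespace EulerPoisson

/-- `(V, E)` is a classical (`C¹`) solution of the one-dimensional repulsive pressureless
Euler-Poisson system with doping profile `c`
`V_t + V V_x = -E`, `E_t + V E_x = c(x) V` (the density being `n = c - E_x`),
with Cauchy data `V(0, x) = V₀(x)`, `E(0, x) = E₀(x)`, on the part `t ≥ 0` of the set `U` of
points `(t, x)` of the space-time plane. It is meant for open `U`; time derivatives at `t = 0`
are one-sided. -/
structure IsClassicalSolution (c V₀ E₀ : ℝ → ℝ) (U : Set (ℝ × ℝ)) (V E : ℝ → ℝ → ℝ) : Prop where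
  contDiffOn_V : ContDiffOn ℝ 1 (Function.uncurry V) (U ∩ {p | 0 ≤ p.1})
  contDiffOn_E : ContDiffOn ℝ 1 (Function.uncurry E) (U ∩ {p | 0 ≤ p.1})
  eq_V : ∀ t x, 0 ≤ t → (t, x) ∈ U →
    derivWithin (fun s => V s x) (Ici 0) t + V t x * deriv (V t) x = -E t x
  eq_E : ∀ t x, 0 ≤ t → (t, x) ∈ U →
    derivWithin (fun s => E s x) (Ici 0) t + V t x * deriv (E t) x = c x * V t x
  initial_V : ∀ x, (0, x) ∈ U → V 0 x = V₀ x
  initial_E : ∀ x, (0, x) ∈ U → E 0 x = E₀ x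

/-- `x` is, on the time interval `[0, T)`, the characteristic of the velocity field `V` that starts
from `x₀`, and it stays inside the set `U` of the space-time plane. -/
structure IsCharacteristic (V : ℝ → ℝ → ℝ) (U : Set (ℝ × ℝ)) (x₀ T : ℝ) (x : ℝ → ℝ) : Prop where
  start : x 0 = x₀
  mem : ∀ t ∈ Ico 0 T, (t, x t) ∈ U
  deriv_eq : ∀ t ∈ Ico 0 T, HasDerivWithinAt x (V t (x t)) (Ici 0) t

/-- The solution of the Cauchy problem blows up at the time `T` along the characteristic starting
from `x₀`: a classical solution exists in a neighbourhood of this characteristic for `0 ≤ t < T`,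
and for every such solution the first derivatives become infinite along the characteristic as
`t → T`. -/
def BlowsUpAlongCharacteristicAt (c V₀ E₀ : ℝ → ℝ) (x₀ T : ℝ) : Prop :=
  (∃ (U : Set (ℝ × ℝ)) (V E : ℝ → ℝ → ℝ) (x : ℝ → ℝ), IsOpen U ∧
    IsClassicalSolution c V₀ E₀ U V E ∧ IsCharacteristic V U x₀ T x) ∧
  ∀ (U : Set (ℝ × ℝ)) (V E : ℝ → ℝ → ℝ) (x : ℝ → ℝ), IsOpen U →
    IsClassicalSolution c V₀ E₀ U V E → IsCharacteristic V U x₀ T x →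
    Tendsto (fun t => |deriv (V t) (x t)| + |deriv (E t) (x t)|) (𝓝[<] T) atTop

end EulerPoisson

/-! Along a characteristic `x'' = -h(x)` with `h' = c`, so a small solution oscillates around a
point near `x₀`, and `c` may be replaced by a globally Lipschitz profile whose derivative has a sign
along the trajectory. The Jacobian `J = ∂x/∂x₀` solves `J'' = n₀ - c J`, where `n₀` is the initial
density, and `V_x = J' / J`, `E_x = c - n₀ / J`. Hence the solution blows up exactly when `J` first
vanishes, and the point is that `J` cannot stay positive.

If `n₀ ≤ 0`, this follows from concavity. If `n₀ > 0` and, say, `c' > 0`, consider the Wronskians of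
`J` and of `J'` with the velocity `V`. The first has derivative `n₀ V`, so it is bounded. The second
has derivative `-c' J V ^ 2`, so it is monotone as long as `J > 0`; it is also bounded, because
`J` is recovered from the two Wronskians, remains positive, and `V` takes both signs. But a
combination of these quantities and of the bounded primitive of `V ^ 3` grows at least like
`∫ V ^ 4`, hence without bound. -/

namespace EulerPoisson

section LipschitzODE

variable {F : Type*} [NormedAddCommGroup F] [NormedSpace ℝ F]

lemma norm_le_of_norm_deriv_right_le {u u' : ℝ → F} {K T δ ε : ℝ} (hK : 0 ≤ K) (hε : 0 ≤ ε)
    (hu : ∀ t ∈ Icc 0 T, HasDerivWithinAt u (u' t) (Icc 0 T) t) (h0 : ‖u 0‖ ≤ δ)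
    (hbound : ∀ t ∈ Icc 0 T, ‖u' t‖ ≤ K * ‖u t‖ + ε) {t : ℝ} (ht : t ∈ Icc 0 T) :
    ‖u t‖ ≤ (δ + ε) * Real.exp ((K + 1) * T) := by
  have hgronwall := norm_le_gronwallBound_of_norm_deriv_right_le (K := K + 1) (ε := ε)
    (fun s hs => (hu s hs).continuousWithinAt)
    (fun s hs => (hu s (Ico_subset_Icc_self hs)).mono_of_mem_nhdsWithin
      (mem_of_superset (Icc_mem_nhdsGE hs.2) (Icc_subset_Icc_left hs.1)))
    h0 (fun s hs => (hbound s (Ico_subset_Icc_self hs)).trans (by nlinarith [norm_nonneg (u s)]))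
    t ht
  rw [gronwallBound_of_K_ne_0 (by positivity), sub_zero] at hgronwall
  have hδ : 0 ≤ δ := (norm_nonneg _).trans h0
  have hexp : 0 ≤ Real.exp ((K + 1) * t) - 1 :=
    sub_nonneg.2 (Real.one_le_exp (mul_nonneg (by positivity) ht.1))
  calc ‖u t‖
      ≤ δ * Real.exp ((K + 1) * t) + ε / (K + 1) * (Real.exp ((K + 1) * t) - 1) := hgronwall
    _ ≤ δ * Real.exp ((K + 1) * t) + ε * Real.exp ((K + 1) * t) := by
        gcongr
        · exact div_le_self hε (le_add_of_nonneg_left hK)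
        · exact sub_le_self _ zero_le_one
    _ = (δ + ε) * Real.exp ((K + 1) * t) := by ring
    _ ≤ (δ + ε) * Real.exp ((K + 1) * T) := by gcongr; exact ht.2

lemma norm_le_of_norm_deriv_le {u u' : ℝ → F} {K T δ ε : ℝ} (hK : 0 ≤ K) (hε : 0 ≤ ε)
    (hu : ∀ t ∈ Icc (-T) T, HasDerivWithinAt u (u' t) (Icc (-T) T) t) (h0 : ‖u 0‖ ≤ δ)
    (hbound : ∀ t ∈ Icc (-T) T, ‖u' t‖ ≤ K * ‖u t‖ + ε) {t : ℝ} (ht : t ∈ Icc (-T) T) :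
    ‖u t‖ ≤ (δ + ε) * Real.exp ((K + 1) * T) := by
  have hmem : ∀ s ∈ Icc 0 T, s ∈ Icc (-T) T ∧ -s ∈ Icc (-T) T := fun s hs =>
    ⟨⟨by linarith [hs.1, hs.2], hs.2⟩, by linarith [hs.2], by linarith [hs.1, hs.2]⟩
  rcases le_total 0 t with h | h
  · exact norm_le_of_norm_deriv_right_le hK hε
      (fun s hs => (hu s (hmem s hs).1).mono fun r hr => (hmem r hr).1) h0
      (fun s hs => hbound s (hmem s hs).1) ⟨h, ht.2⟩
  · have hreflected := norm_le_of_norm_deriv_right_le (u := fun s => u (-s))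
      (u' := fun s => -u' (-s)) hK hε
      (fun s hs => by
        simpa [Function.comp_def] using
          (hu (-s) (hmem s hs).2).scomp (h := fun r => -r) (s := Icc 0 T) s
            (hasDerivAt_neg s).hasDerivWithinAt fun r hr => (hmem r hr).2)
      (by simpa using h0) (fun s hs => by simpa using hbound (-s) (hmem s hs).2)
      (t := -t) ⟨by linarith, by linarith [ht.1]⟩
    simpa using hreflected

/-- The radial retraction onto the closed ball of radius `R` about the origin. -/
noncomputable def radialRetraction (R : ℝ) (y : F) : F := (R / max R ‖y‖) • y

lemma radialRetraction_of_norm_le {R : ℝ} (hR : 0 < R) {y : F} (hy : ‖y‖ ≤ R) :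
    radialRetraction R y = y := by
  rw [radialRetraction, max_eq_left hy, div_self hR.ne', one_smul]

lemma norm_radialRetraction_le {R : ℝ} (hR : 0 < R) (y : F) : ‖radialRetraction R y‖ ≤ R := by
  have hmax : 0 < max R ‖y‖ := lt_max_of_lt_left hR
  rw [radialRetraction, norm_smul, Real.norm_of_nonneg (by positivity), div_mul_eq_mul_div,
    div_le_iff₀ hmax]
  gcongr
  exact le_max_right _ _

lemma norm_radialRetraction_le_norm {R : ℝ} (hR : 0 < R) (y : F) :
    ‖radialRetraction R y‖ ≤ ‖y‖ := by
  have hmax : 0 < max R ‖y‖ := lt_max_of_lt_left hR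
  rw [radialRetraction, norm_smul, Real.norm_of_nonneg (by positivity)]
  exact mul_le_of_le_one_left (norm_nonneg y) ((div_le_one hmax).2 (le_max_left _ _))

lemma lipschitzWith_radialRetraction {R : ℝ} (hR : 0 < R) :
    LipschitzWith 2 (radialRetraction R : F → F) := by
  refine LipschitzWith.of_dist_le_mul fun y z => ?_
  set p := max R ‖y‖
  set q := max R ‖z‖
  have hp : 0 < p := lt_max_of_lt_left hR
  have hq : 0 < q := lt_max_of_lt_left hR
  have hsplit : radialRetraction R y - radialRetraction R z
      = (R / p) • (y - z) + ((R / p) * ((q - p) / q)) • z := by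
    rw [show R / p * ((q - p) / q) = R / p - R / q by field_simp, sub_smul, smul_sub]
    simp only [radialRetraction, p, q]
    abel
  have hpq : |q - p| ≤ ‖y - z‖ := by
    rw [abs_sub_comm]
    exact (abs_max_sub_max_le_max R ‖y‖ R ‖z‖).trans
      (max_le (by simp) (abs_norm_sub_norm_le y z))
  have hRp : R / p ≤ 1 := (div_le_one hp).2 (le_max_left _ _)
  have hzq : ‖z‖ / q ≤ 1 := (div_le_one hq).2 (le_max_right _ _)
  rw [dist_eq_norm, dist_eq_norm, hsplit]
  calc ‖(R / p) • (y - z) + ((R / p) * ((q - p) / q)) • z‖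
      ≤ R / p * ‖y - z‖ + R / p * (|q - p| / q) * ‖z‖ := by
        refine (norm_add_le _ _).trans_eq ?_
        rw [norm_smul, norm_smul, norm_mul, norm_div, norm_div, Real.norm_of_nonneg hR.le,
          Real.norm_of_nonneg hp.le, Real.norm_of_nonneg hq.le, Real.norm_eq_abs]
    _ = R / p * (‖y - z‖ + |q - p| * (‖z‖ / q)) := by ring
    _ ≤ 1 * (‖y - z‖ + ‖y - z‖ * 1) := by gcongr
    _ = (2 : NNReal) * ‖y - z‖ := by push_cast; ring

-- Cutting off the argument makes the field bounded; by Grönwall the solution never feels it.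
theorem exists_hasDerivWithinAt_Icc_of_lipschitzWith [CompleteSpace F] {f : ℝ → F → F}
    {K : NNReal} (hf : ∀ t, LipschitzWith K (f t)) (hcont : ∀ y, Continuous fun t => f t y) (y₀ : F)
    {T : ℝ} (hT : 0 ≤ T) :
    ∃ α : ℝ → F, α 0 = y₀ ∧ ∀ t ∈ Icc (-T) T, HasDerivWithinAt α (f t (α t)) (Icc (-T) T) t := by
  obtain ⟨m, hm⟩ :=
    isCompact_Icc.exists_bound_of_continuousOn (hcont 0).continuousOn (s := Icc (-T) T)
  have h0 : (0 : ℝ) ∈ Icc (-T) T := ⟨by linarith, hT⟩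
  have hm0 : 0 ≤ m := (norm_nonneg _).trans (hm 0 h0)
  have hgrowth : ∀ t ∈ Icc (-T) T, ∀ y, ‖f t y‖ ≤ K * ‖y‖ + m := fun t ht y => by
    have hlip := (hf t).norm_sub_le y 0
    rw [sub_zero] at hlip
    linarith [norm_le_norm_sub_add (f t y) (f t 0), hm t ht]
  set R := (‖y₀‖ + m) * Real.exp ((K + 1) * T) + 1
  have hR : 0 < R := by positivity
  set χ : F → F := radialRetraction R
  have hPL : IsPicardLindelof (fun t y => f t (χ y)) (⟨0, h0⟩ : Icc (-T) T) y₀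
      ((K * R.toNNReal + m.toNNReal) * T.toNNReal) 0 (K * R.toNNReal + m.toNNReal) (K * 2) :=
    { lipschitzOnWith := fun t _ =>
        ((hf t).comp (lipschitzWith_radialRetraction hR)).lipschitzOnWith
      continuousOn := fun y _ => (hcont _).continuousOn
      norm_le := fun t ht y _ => (hgrowth t ht _).trans (by
        push_cast
        rw [Real.coe_toNNReal R hR.le, Real.coe_toNNReal m hm0]
        gcongr
        exact norm_radialRetraction_le hR y)
      mul_max_le := by simp [Real.coe_toNNReal T hT] }
  obtain ⟨α, hα0, hα⟩ := hPL.exists_eq_forall_mem_Icc_hasDerivWithinAt₀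
  replace hα0 : α 0 = y₀ := hα0
  refine ⟨α, hα0, fun t ht => ?_⟩
  have hαR : ‖α t‖ ≤ (‖y₀‖ + m) * Real.exp ((K + 1) * T) :=
    norm_le_of_norm_deriv_le K.coe_nonneg hm0 hα (by rw [hα0])
      (fun s hs => (hgrowth s hs _).trans (by
        gcongr
        exact norm_radialRetraction_le_norm hR (α s))) ht
  simpa only [χ, radialRetraction_of_norm_le hR (hαR.trans (lt_add_one _).le)] using hα t ht

theorem exists_hasDerivAt_of_lipschitzWith [CompleteSpace F] {f : ℝ → F → F} {K : NNReal}
    (hf : ∀ t, LipschitzWith K (f t)) (hcont : ∀ y, Continuous fun t => f t y) (y₀ : F) :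
    ∃ α : ℝ → F, α 0 = y₀ ∧ ∀ t, HasDerivAt α (f t (α t)) t := by
  choose α hα0 hα using fun n : ℕ =>
    exists_hasDerivWithinAt_Icc_of_lipschitzWith hf hcont y₀ (T := (n : ℝ) + 1) (by positivity)
  have hderiv : ∀ (n : ℕ) (t : ℝ), |t| < n + 1 → HasDerivAt (α n) (f t (α n t)) t := fun n t ht =>
    (hα n t (abs_le.1 ht.le)).hasDerivAt (Icc_mem_nhds (abs_lt.1 ht).1 (abs_lt.1 ht).2)
  have hagree : ∀ (n m : ℕ) (t : ℝ), |t| < n + 1 → |t| < m + 1 → α n t = α m t := by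
    intro n m t hn hm
    set r : ℝ := min (n + 1) (m + 1)
    have hr : 0 < r := lt_min (by positivity) (by positivity)
    exact ODE_solution_unique_of_mem_Ioo (s := fun _ => univ) (a := -r) (b := r)
      (fun t _ => (hf t).lipschitzOnWith) ⟨neg_lt_zero.2 hr, hr⟩
      (fun s hs => ⟨hderiv n s ((abs_lt.2 hs).trans_le (min_le_left _ _)), mem_univ _⟩)
      (fun s hs => ⟨hderiv m s ((abs_lt.2 hs).trans_le (min_le_right _ _)), mem_univ _⟩)
      ((hα0 n).trans (hα0 m).symm) (abs_lt.1 (lt_min hn hm))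
  have hfloor : ∀ t : ℝ, |t| < ⌊|t|⌋₊ + 1 := fun t => Nat.lt_floor_add_one _
  refine ⟨fun t => α ⌊|t|⌋₊ t, hα0 _, fun t => ?_⟩
  have hlocal : (fun s => α ⌊|s|⌋₊ s) =ᶠ[𝓝 t] α ⌊|t|⌋₊ := by
    filter_upwards [(isOpen_lt continuous_abs continuous_const).mem_nhds (hfloor t)] with s hs
    exact hagree _ _ s (hfloor s) hs
  exact (hderiv _ t (hfloor t)).congr_of_eventuallyEq hlocal

end LipschitzODE

section SmoothFlow

variable {F : Type*} [NormedAddCommGroup F] [NormedSpace ℝ F]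

/-- `φ` is the global flow of the autonomous differential equation `y' = f y`. -/
structure IsGlobalFlow (f : F → F) (φ : ℝ → F → F) : Prop where
  map_zero : ∀ y, φ 0 y = y
  hasDerivAt : ∀ t y, HasDerivAt (fun s => φ s y) (f (φ t y)) t

/-- `A` is the fundamental solution of the equation of first variation along the curves `φ · y`,
where `f'` is the derivative of the vector field. -/
structure IsVariationalFlow (f' : F → F →L[ℝ] F) (φ : ℝ → F → F) (A : ℝ → F → F →L[ℝ] F) :
    Prop where
  map_zero : ∀ y, A 0 y = ContinuousLinearMap.id ℝ F
  hasDerivAt : ∀ t y, HasDerivAt (fun s => A s y) (f' (φ t y) ∘L A t y) t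

lemma norm_sub_sub_le_of_lipschitzWith_deriv {f : F → F} {f' : F → F →L[ℝ] F} {L : NNReal}
    (hf : ∀ y, HasFDerivAt f (f' y) y) (hL : LipschitzWith L f') (y z : F) :
    ‖f z - f y - f' y (z - y)‖ ≤ L * ‖z - y‖ ^ 2 := by
  have hbound : ∀ w ∈ Metric.closedBall y ‖z - y‖, ‖f' w - f' y‖ ≤ L * ‖z - y‖ := fun w hw =>
    (hL.norm_sub_le w y).trans (by gcongr; rwa [← dist_eq_norm])
  calc ‖f z - f y - f' y (z - y)‖
      ≤ L * ‖z - y‖ * ‖z - y‖ :=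
        (convex_closedBall y _).norm_image_sub_le_of_norm_hasFDerivWithin_le'
          (fun w _ => (hf w).hasFDerivWithinAt) hbound
          (Metric.mem_closedBall_self (norm_nonneg _)) (by simp [dist_eq_norm])
    _ = L * ‖z - y‖ ^ 2 := by ring

lemma continuous_uncurry_of_lipschitzOnWith_Icc {Y Z : Type*} [PseudoMetricSpace Y]
    [PseudoMetricSpace Z] {g : ℝ → Y → Z} (hcont : ∀ y, Continuous fun t => g t y)
    (hlip : ∀ T, ∃ C : NNReal, ∀ t ∈ Icc (-T) T, LipschitzWith C (g t)) :
    Continuous (Function.uncurry g) := by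
  refine continuous_iff_continuousAt.2 fun ⟨t, y⟩ => ?_
  obtain ⟨C, hC⟩ := hlip (|t| + 1)
  have hcontOn : ContinuousOn (Function.uncurry g) (Icc (-(|t| + 1)) (|t| + 1) ×ˢ univ) :=
    continuousOn_prod_of_continuousOn_lipschitzOnWith' _ C (fun s hs => (hC s hs).lipschitzOnWith)
      fun y _ => (hcont y).continuousOn
  have ht : |t| < |t| + 1 := lt_add_one _
  exact hcontOn.continuousAt (prod_mem_nhds (Icc_mem_nhds (abs_lt.1 ht).1 (abs_lt.1 ht).2) univ_mem)

theorem exists_isGlobalFlow [CompleteSpace F] {f : F → F} {K : NNReal} (hK : LipschitzWith K f) :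
    ∃ φ, IsGlobalFlow f φ := by
  choose α hα0 hα using fun y => exists_hasDerivAt_of_lipschitzWith (f := fun _ => f)
    (fun _ => hK) (fun _ => continuous_const) y
  exact ⟨fun t y => α y t, hα0, fun t y => hα y t⟩

variable {f : F → F} {f' : F → F →L[ℝ] F} {φ : ℝ → F → F} {A : ℝ → F → F →L[ℝ] F}
  {K L : NNReal} {T t : ℝ}

lemma IsGlobalFlow.continuous (hφ : IsGlobalFlow f φ) (y : F) : Continuous fun t => φ t y :=
  continuous_iff_continuousAt.2 fun t => (hφ.hasDerivAt t y).continuousAt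

theorem IsGlobalFlow.exists_isVariationalFlow [CompleteSpace F] (hφ : IsGlobalFlow f φ)
    (hK : ∀ y, ‖f' y‖ ≤ K) (hf' : Continuous f') : ∃ A, IsVariationalFlow f' φ A := by
  choose α hα0 hα using fun y => exists_hasDerivAt_of_lipschitzWith
    (f := fun t (B : F →L[ℝ] F) => f' (φ t y) ∘L B) (K := K)
    (fun t => LipschitzWith.of_dist_le_mul fun B C => by
      rw [dist_eq_norm, dist_eq_norm, ← ContinuousLinearMap.comp_sub]
      exact (ContinuousLinearMap.opNorm_comp_le _ _).trans (by gcongr; exact hK _))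
    (fun B => (hf'.comp (hφ.continuous y)).clm_comp continuous_const)
    (ContinuousLinearMap.id ℝ F)
  exact ⟨fun t y => α y t, hα0, fun t y => hα y t⟩

lemma IsGlobalFlow.norm_sub_le (hφ : IsGlobalFlow f φ) (hK : LipschitzWith K f)
    (ht : t ∈ Icc (-T) T) (y z : F) :
    ‖φ t z - φ t y‖ ≤ Real.exp ((K + 1) * T) * ‖z - y‖ := by
  have hgronwall := norm_le_of_norm_deriv_le K.coe_nonneg le_rfl
    (fun s _ => ((hφ.hasDerivAt s z).sub (hφ.hasDerivAt s y)).hasDerivWithinAt)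
    (by simp [hφ.map_zero]) (fun s _ => by simpa using hK.norm_sub_le (φ s z) (φ s y)) ht
    (δ := ‖z - y‖)
  simpa [mul_comm] using hgronwall

lemma IsVariationalFlow.norm_le (hA : IsVariationalFlow f' φ A) (hK : ∀ y, ‖f' y‖ ≤ K)
    (ht : t ∈ Icc (-T) T) (y : F) : ‖A t y‖ ≤ Real.exp ((K + 1) * T) := by
  have hgronwall := norm_le_of_norm_deriv_le K.coe_nonneg le_rfl
    (fun s _ => (hA.hasDerivAt s y).hasDerivWithinAt)
    (by rw [hA.map_zero]; exact ContinuousLinearMap.norm_id_le)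
    (fun s _ => by
      rw [add_zero]
      exact (ContinuousLinearMap.opNorm_comp_le _ _).trans (by gcongr; exact hK _)) ht
    (δ := 1)
  simpa using hgronwall

lemma IsVariationalFlow.norm_sub_le (hA : IsVariationalFlow f' φ A) (hφ : IsGlobalFlow f φ)
    (hf : LipschitzWith K f) (hK : ∀ y, ‖f' y‖ ≤ K) (hL : LipschitzWith L f')
    (ht : t ∈ Icc (-T) T) (y z : F) :
    ‖A t z - A t y‖ ≤ L * Real.exp ((K + 1) * T) ^ 3 * ‖z - y‖ := by
  set e := Real.exp ((K + 1) * T)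
  have hgronwall := norm_le_of_norm_deriv_le (δ := 0) (ε := L * (e * ‖z - y‖) * e)
    K.coe_nonneg (by positivity)
    (fun s _ => ((hA.hasDerivAt s z).sub (hA.hasDerivAt s y)).hasDerivWithinAt)
    (by simp [hA.map_zero]) (fun s hs => by
      calc ‖f' (φ s z) ∘L A s z - f' (φ s y) ∘L A s y‖
          = ‖f' (φ s z) ∘L (A s z - A s y) + (f' (φ s z) - f' (φ s y)) ∘L A s y‖ := by
            rw [ContinuousLinearMap.comp_sub, ContinuousLinearMap.sub_comp, sub_add_sub_cancel]
        _ ≤ ‖f' (φ s z)‖ * ‖A s z - A s y‖ + ‖f' (φ s z) - f' (φ s y)‖ * ‖A s y‖ :=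
            (norm_add_le _ _).trans (add_le_add (ContinuousLinearMap.opNorm_comp_le _ _)
              (ContinuousLinearMap.opNorm_comp_le _ _))
        _ ≤ K * ‖A s z - A s y‖ + L * (e * ‖z - y‖) * e := by
            gcongr
            · exact hK _
            · exact (hL.norm_sub_le _ _).trans (by gcongr; exact hφ.norm_sub_le hf hs y z)
            · exact hA.norm_le hK hs y) ht
  calc ‖A t z - A t y‖ ≤ (0 + L * (e * ‖z - y‖) * e) * e := hgronwall
    _ = L * e ^ 3 * ‖z - y‖ := by ring

lemma IsVariationalFlow.norm_sub_sub_le (hA : IsVariationalFlow f' φ A) (hφ : IsGlobalFlow f φ)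
    (hf : ∀ y, HasFDerivAt f (f' y) y) (hK : LipschitzWith K f) (hL : LipschitzWith L f')
    (ht : t ∈ Icc (-T) T) (y z : F) :
    ‖φ t z - φ t y - A t y (z - y)‖ ≤ L * Real.exp ((K + 1) * T) ^ 3 * ‖z - y‖ ^ 2 := by
  set e := Real.exp ((K + 1) * T)
  have hgronwall := norm_le_of_norm_deriv_le (δ := 0) (ε := L * (e * ‖z - y‖) ^ 2)
    K.coe_nonneg (by positivity)
    (fun s _ => (((hφ.hasDerivAt s z).sub (hφ.hasDerivAt s y)).sub
      ((hA.hasDerivAt s y).clm_apply (hasDerivAt_const s (z - y)))).hasDerivWithinAt)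
    (by simp [hφ.map_zero, hA.map_zero]) (fun s hs => by
      calc ‖f (φ s z) - f (φ s y) - ((f' (φ s y) ∘L A s y) (z - y) + A s y 0)‖
          = ‖f' (φ s y) (φ s z - φ s y - A s y (z - y))
              + (f (φ s z) - f (φ s y) - f' (φ s y) (φ s z - φ s y))‖ := by
            simp only [map_sub, (A s y).map_zero, ContinuousLinearMap.comp_apply]
            congr 1
            abel
        _ ≤ K * ‖φ s z - φ s y - A s y (z - y)‖ + L * ‖φ s z - φ s y‖ ^ 2 :=
            (norm_add_le _ _).trans (add_le_add
              (ContinuousLinearMap.le_of_opNorm_le _ ((hf _).le_of_lipschitz hK) _)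
              (norm_sub_sub_le_of_lipschitzWith_deriv hf hL _ _))
        _ ≤ K * ‖φ s z - φ s y - A s y (z - y)‖ + L * (e * ‖z - y‖) ^ 2 := by
            gcongr
            exact hφ.norm_sub_le hK hs y z) ht
  calc ‖φ t z - φ t y - A t y (z - y)‖ ≤ (0 + L * (e * ‖z - y‖) ^ 2) * e := hgronwall
    _ = L * e ^ 3 * ‖z - y‖ ^ 2 := by ring

lemma IsVariationalFlow.hasDerivAt_apply (hA : IsVariationalFlow f' φ A) (t : ℝ) (y w : F) :
    HasDerivAt (fun s => A s y w) (f' (φ t y) (A t y w)) t :=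
  ((hA.hasDerivAt t y).clm_apply (hasDerivAt_const t w)).congr_deriv (by simp)

theorem IsVariationalFlow.hasFDerivAt (hA : IsVariationalFlow f' φ A) (hφ : IsGlobalFlow f φ)
    (hf : ∀ y, HasFDerivAt f (f' y) y) (hK : LipschitzWith K f) (hL : LipschitzWith L f')
    (t : ℝ) (y : F) : HasFDerivAt (φ t) (A t y) y := by
  refine HasFDerivAt.of_isLittleO (Asymptotics.IsBigO.trans_isLittleO
    (Asymptotics.IsBigO.of_bound (L * Real.exp ((K + 1) * |t|) ^ 3)
      (Eventually.of_forall fun z => ?_))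
    (Asymptotics.isLittleO_pow_sub_sub y one_lt_two))
  rw [Real.norm_of_nonneg (by positivity)]
  exact hA.norm_sub_sub_le hφ hf hK hL (abs_le.1 le_rfl) y z

theorem IsVariationalFlow.contDiff_uncurry (hA : IsVariationalFlow f' φ A)
    (hφ : IsGlobalFlow f φ) (hf : ∀ y, HasFDerivAt f (f' y) y) (hK : LipschitzWith K f)
    (hL : LipschitzWith L f') : ContDiff ℝ 1 (Function.uncurry φ) := by
  have hcont_φ : Continuous (Function.uncurry φ) :=
    continuous_uncurry_of_lipschitzOnWith_Icc hφ.continuous fun T =>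
      ⟨(Real.exp ((K + 1) * T)).toNNReal, fun t ht => LipschitzWith.of_dist_le_mul fun z y => by
        rw [Real.coe_toNNReal _ (Real.exp_pos _).le, dist_eq_norm, dist_eq_norm]
        exact hφ.norm_sub_le hK ht y z⟩
  have hcont_A : Continuous (Function.uncurry A) :=
    continuous_uncurry_of_lipschitzOnWith_Icc
      (fun y => continuous_iff_continuousAt.2 fun t => (hA.hasDerivAt t y).continuousAt) fun T =>
      ⟨(L * Real.exp ((K + 1) * T) ^ 3).toNNReal, fun t ht =>
        LipschitzWith.of_dist_le_mul fun z y => by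
          rw [Real.coe_toNNReal _ (by positivity), dist_eq_norm, dist_eq_norm]
          exact hA.norm_sub_le hφ hK (fun y => (hf y).le_of_lipschitz hK) hL ht y z⟩
  have hcont_time : Continuous fun p : ℝ × F =>
      ContinuousLinearMap.toSpanSingleton ℝ (f (φ p.1 p.2)) :=
    (ContinuousLinearMap.toSpanSingletonCLE (𝕜 := ℝ) (E := F)).continuous.comp
      (hK.continuous.comp hcont_φ)
  refine contDiff_one_iff_hasFDerivAt.2 ⟨_, hcont_time.continuousLinearMapCoprod hcont_A,
    fun p => (hasStrictFDerivAt_uncurry_coprod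
      (f₁ := fun t y => ContinuousLinearMap.toSpanSingleton ℝ (f (φ t y)))
      (Eventually.of_forall fun q => (hφ.hasDerivAt q.1 q.2).hasFDerivAt)
      (Eventually.of_forall fun q => hA.hasFDerivAt hφ hf hK hL q.1 q.2)
      hcont_time.continuousAt hcont_A.continuousAt).hasFDerivAt⟩

end SmoothFlow

section LagrangianFlow

/-- The initial density `n₀ = γ - E₀'` for the doping profile `γ`. -/
noncomputable def initialDensity (γ E₀ : ℝ → ℝ) (a : ℝ) : ℝ := γ a - deriv E₀ a

/-- The Euler-Poisson system with profile `γ` in Lagrangian coordinates: `X t a`, `V t a` and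
`E t a` are the position, the velocity and the field at time `t` of the particle that starts from
`a`, and `J`, `P` stand for `∂X/∂a`, `∂V/∂a`. -/
structure LagrangianFlow (γ V₀ E₀ : ℝ → ℝ) (X V E J P : ℝ → ℝ → ℝ) : Prop where
  X_zero : ∀ a, X 0 a = a
  V_zero : ∀ a, V 0 a = V₀ a
  E_zero : ∀ a, E 0 a = E₀ a
  J_zero : ∀ a, J 0 a = 1
  hasDerivAt_X : ∀ t a, HasDerivAt (fun s => X s a) (V t a) t
  hasDerivAt_V : ∀ t a, HasDerivAt (fun s => V s a) (-E t a) t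
  hasDerivAt_E : ∀ t a, HasDerivAt (fun s => E s a) (γ (X t a) * V t a) t
  hasDerivAt_J : ∀ t a, HasDerivAt (fun s => J s a) (P t a) t
  hasDerivAt_P : ∀ t a,
    HasDerivAt (fun s => P s a) (initialDensity γ E₀ a - γ (X t a) * J t a) t
  hasDerivAt_X_label : ∀ t a, HasDerivAt (X t) (J t a) a
  hasDerivAt_V_label : ∀ t a, HasDerivAt (V t) (P t a) a
  hasDerivAt_E_label : ∀ t a, HasDerivAt (E t) (γ (X t a) * J t a - initialDensity γ E₀ a) a
  contDiff_X : ContDiff ℝ 1 (Function.uncurry X)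
  contDiff_V : ContDiff ℝ 1 (Function.uncurry V)
  contDiff_E : ContDiff ℝ 1 (Function.uncurry E)

/-- The vector field of `x' = v`, `v' = k - Φ x`, `k' = 0`. Along a characteristic `E = Φ(x) - k`
with a constant `k`, where `Φ` is a primitive of the profile; the unknown `k` replaces `E` because
this field, unlike that of `(x, v, E)`, is globally Lipschitz. -/
def characteristicField (Φ : ℝ → ℝ) (p : ℝ × ℝ × ℝ) : ℝ × ℝ × ℝ := (p.2.1, p.2.2 - Φ p.1, 0)

/-- The derivative of `characteristicField Φ`, where `γ` is the derivative of `Φ`. -/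
noncomputable def characteristicFieldDeriv (γ : ℝ → ℝ) (p : ℝ × ℝ × ℝ) :
    ℝ × ℝ × ℝ →L[ℝ] ℝ × ℝ × ℝ :=
  let x := ContinuousLinearMap.fst ℝ ℝ (ℝ × ℝ)
  let vk := ContinuousLinearMap.snd ℝ ℝ (ℝ × ℝ)
  (ContinuousLinearMap.fst ℝ ℝ ℝ ∘L vk).prod
    ((ContinuousLinearMap.snd ℝ ℝ ℝ ∘L vk - γ p.1 • x).prod 0)

lemma characteristicFieldDeriv_apply (γ : ℝ → ℝ) (p w : ℝ × ℝ × ℝ) :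
    characteristicFieldDeriv γ p w = (w.2.1, w.2.2 - γ p.1 * w.1, 0) := rfl

variable {Φ γ V₀ E₀ : ℝ → ℝ}

lemma hasFDerivAt_characteristicField (hΦ : ∀ x, HasDerivAt Φ (γ x) x) (p : ℝ × ℝ × ℝ) :
    HasFDerivAt (characteristicField Φ) (characteristicFieldDeriv γ p) p :=
  (hasFDerivAt_snd.fst).prodMk
    (((hasFDerivAt_snd.snd).sub ((hΦ p.1).comp_hasFDerivAt p hasFDerivAt_fst)).prodMk
      (hasFDerivAt_const 0 p))

lemma norm_characteristicFieldDeriv_le {B : NNReal} (hB : ∀ x, |γ x| ≤ B) (p : ℝ × ℝ × ℝ) :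
    ‖characteristicFieldDeriv γ p‖ ≤ (1 + B : NNReal) := by
  refine ContinuousLinearMap.opNorm_le_bound _ (1 + B).coe_nonneg fun w => ?_
  have h₁ : |w.1| ≤ ‖w‖ := norm_fst_le w
  have h₂ : |w.2.1| ≤ ‖w‖ := (norm_fst_le w.2).trans (norm_snd_le w)
  have h₃ : |w.2.2| ≤ ‖w‖ := (norm_snd_le w.2).trans (norm_snd_le w)
  have hγ : |γ p.1 * w.1| ≤ B * ‖w‖ := by rw [abs_mul]; gcongr; exact hB _
  have hBw : 0 ≤ B * ‖w‖ := by positivity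
  rw [characteristicFieldDeriv_apply, NNReal.coe_add, NNReal.coe_one, add_mul, one_mul]
  simp only [norm_prod_le_iff, Real.norm_eq_abs, abs_zero]
  exact ⟨by linarith, (abs_sub _ _).trans (by linarith), by positivity⟩

lemma lipschitzWith_characteristicField {B : NNReal} (hΦ : ∀ x, HasDerivAt Φ (γ x) x)
    (hB : ∀ x, |γ x| ≤ B) : LipschitzWith (1 + B) (characteristicField Φ) := by
  refine lipschitzWith_of_nnnorm_fderiv_le (𝕜 := ℝ)
    (fun p => (hasFDerivAt_characteristicField hΦ p).differentiableAt) fun p => ?_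
  rw [(hasFDerivAt_characteristicField hΦ p).fderiv]
  exact norm_characteristicFieldDeriv_le hB p

lemma lipschitzWith_characteristicFieldDeriv {L : NNReal} (hL : LipschitzWith L γ) :
    LipschitzWith L (characteristicFieldDeriv γ) := by
  refine LipschitzWith.of_dist_le_mul fun p q => ?_
  rw [dist_eq_norm, dist_eq_norm]
  refine ContinuousLinearMap.opNorm_le_bound _ (by positivity) fun w => ?_
  have hγ : |γ q.1 - γ p.1| ≤ L * ‖p - q‖ := by
    rw [norm_sub_rev]
    exact (hL.norm_sub_le q.1 p.1).trans (by gcongr; exact norm_fst_le (q - p))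
  have hw : |(γ q.1 - γ p.1) * w.1| ≤ L * ‖p - q‖ * ‖w‖ := by
    rw [abs_mul]
    gcongr
    exact norm_fst_le w
  have hdiff : (characteristicFieldDeriv γ p - characteristicFieldDeriv γ q) w
      = (0, (γ q.1 - γ p.1) * w.1, 0) := by
    rw [sub_apply]
    ext <;> simp only [characteristicFieldDeriv_apply, Prod.fst_sub, Prod.snd_sub] <;> ring
  rw [hdiff]
  simp only [norm_prod_le_iff, Real.norm_eq_abs, abs_zero]
  exact ⟨by positivity, hw, by positivity⟩

lemma IsGlobalFlow.hasDerivAt_characteristicField {φ : ℝ → ℝ × ℝ × ℝ → ℝ × ℝ × ℝ}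
    (hφ : IsGlobalFlow (characteristicField Φ) φ) (t : ℝ) (y : ℝ × ℝ × ℝ) :
    HasDerivAt (fun s => (φ s y).1) (φ t y).2.1 t ∧
      HasDerivAt (fun s => (φ s y).2.1) ((φ t y).2.2 - Φ (φ t y).1) t ∧
      HasDerivAt (fun s => (φ s y).2.2) 0 t :=
  ⟨(hφ.hasDerivAt t y).fst, (hφ.hasDerivAt t y).snd.fst, (hφ.hasDerivAt t y).snd.snd⟩

lemma IsVariationalFlow.hasDerivAt_characteristicField {φ : ℝ → ℝ × ℝ × ℝ → ℝ × ℝ × ℝ}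
    {A : ℝ → ℝ × ℝ × ℝ → ℝ × ℝ × ℝ →L[ℝ] ℝ × ℝ × ℝ}
    (hA : IsVariationalFlow (characteristicFieldDeriv γ) φ A) (t : ℝ) (y w : ℝ × ℝ × ℝ) :
    HasDerivAt (fun s => (A s y w).1) (A t y w).2.1 t ∧
      HasDerivAt (fun s => (A s y w).2.1) (w.2.2 - γ (φ t y).1 * (A t y w).1) t ∧
      (A t y w).2.2 = w.2.2 := by
  have hconst : ∀ s, HasDerivAt (fun s => (A s y w).2.2) 0 s := fun s =>
    (hA.hasDerivAt_apply s y w).snd.snd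
  have hthird : (A t y w).2.2 = w.2.2 := by
    rw [is_const_of_deriv_eq_zero (fun s => (hconst s).differentiableAt)
      (fun s => (hconst s).deriv) t 0, hA.map_zero, ContinuousLinearMap.id_apply]
  exact ⟨(hA.hasDerivAt_apply t y w).fst, hthird ▸ (hA.hasDerivAt_apply t y w).snd.fst, hthird⟩

/-- The curve of initial states of `characteristicField Φ` for the Cauchy data `V₀`, `E₀`. -/
def initialCurve (Φ V₀ E₀ : ℝ → ℝ) (a : ℝ) : ℝ × ℝ × ℝ := (a, V₀ a, Φ a - E₀ a)

/-- The tangent vector of `initialCurve Φ V₀ E₀`, where `γ` is the derivative of `Φ`. -/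
noncomputable def initialTangent (γ V₀ E₀ : ℝ → ℝ) (a : ℝ) : ℝ × ℝ × ℝ :=
  (1, deriv V₀ a, initialDensity γ E₀ a)

lemma hasDerivAt_initialCurve (hΦ : ∀ x, HasDerivAt Φ (γ x) x) (hV₀ : Differentiable ℝ V₀)
    (hE₀ : Differentiable ℝ E₀) (a : ℝ) :
    HasDerivAt (initialCurve Φ V₀ E₀) (initialTangent γ V₀ E₀ a) a :=
  (hasDerivAt_id a).prodMk ((hV₀ a).hasDerivAt.prodMk ((hΦ a).sub (hE₀ a).hasDerivAt))

theorem IsVariationalFlow.lagrangianFlow {φ : ℝ → ℝ × ℝ × ℝ → ℝ × ℝ × ℝ}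
    {A : ℝ → ℝ × ℝ × ℝ → ℝ × ℝ × ℝ →L[ℝ] ℝ × ℝ × ℝ} {K L : NNReal}
    (hA : IsVariationalFlow (characteristicFieldDeriv γ) φ A)
    (hφ : IsGlobalFlow (characteristicField Φ) φ) (hΦ : ∀ x, HasDerivAt Φ (γ x) x)
    (hK : LipschitzWith K (characteristicField Φ))
    (hL : LipschitzWith L (characteristicFieldDeriv γ)) (hγ : Continuous γ)
    (hV₀ : ContDiff ℝ 1 V₀) (hE₀ : ContDiff ℝ 1 E₀) {y w : ℝ → ℝ × ℝ × ℝ}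
    (hy : y = initialCurve Φ V₀ E₀) (hw : w = initialTangent γ V₀ E₀) :
    LagrangianFlow γ V₀ E₀ (fun t a => (φ t (y a)).1) (fun t a => (φ t (y a)).2.1)
      (fun t a => Φ (φ t (y a)).1 - (φ t (y a)).2.2) (fun t a => (A t (y a) (w a)).1)
      (fun t a => (A t (y a) (w a)).2.1) := by
  have hΦ1 : ContDiff ℝ 1 Φ := contDiff_one_iff_deriv.2
    ⟨fun x => (hΦ x).differentiableAt, by rwa [deriv_eq hΦ]⟩
  have hy1 : ContDiff ℝ 1 y := hy ▸ contDiff_id.prodMk (hV₀.prodMk (hΦ1.sub hE₀))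
  have hφ1 : ContDiff ℝ 1 fun p : ℝ × ℝ => φ p.1 (y p.2) :=
    (hA.contDiff_uncurry hφ (hasFDerivAt_characteristicField hΦ) hK hL).comp
      (contDiff_fst.prodMk (hy1.comp contDiff_snd))
  have hy' : ∀ a, HasDerivAt y (w a) a := hy ▸ hw ▸ hasDerivAt_initialCurve hΦ
    (hV₀.differentiable one_ne_zero) (hE₀.differentiable one_ne_zero)
  have hφa : ∀ t a, HasDerivAt (fun b => φ t (y b)) (A t (y a) (w a)) a := fun t a =>
    (hA.hasFDerivAt hφ (hasFDerivAt_characteristicField hΦ) hK hL t (y a)).comp_hasDerivAt a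
      (hy' a)
  have hXa : ∀ t a, HasDerivAt (fun b => (φ t (y b)).1) (A t (y a) (w a)).1 a := fun t a =>
    (hφa t a).fst
  have hka : ∀ t a, HasDerivAt (fun b => (φ t (y b)).2.2) (w a).2.2 a := fun t a =>
    (hA.hasDerivAt_characteristicField t (y a) (w a)).2.2 ▸ (hφa t a).snd.snd
  have hn₀ : ∀ a, (w a).2.2 = initialDensity γ E₀ a := fun a => by rw [hw, initialTangent]
  have hφt := fun t a => hφ.hasDerivAt_characteristicField t (y a)
  have hAt := fun t a => hA.hasDerivAt_characteristicField t (y a) (w a)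
  exact
    { X_zero := fun a => by simp [hφ.map_zero, hy, initialCurve]
      V_zero := fun a => by simp [hφ.map_zero, hy, initialCurve]
      E_zero := fun a => by simp [hφ.map_zero, hy, initialCurve]
      J_zero := fun a => by simp [hA.map_zero, hw, initialTangent]
      hasDerivAt_X := fun t a => (hφt t a).1
      hasDerivAt_V := fun t a => (hφt t a).2.1.congr_deriv (neg_sub _ _).symm
      hasDerivAt_E := fun t a =>
        (((hΦ _).comp t (hφt t a).1).sub (hφt t a).2.2).congr_deriv (sub_zero _)
      hasDerivAt_J := fun t a => (hAt t a).1
      hasDerivAt_P := fun t a => hn₀ a ▸ (hAt t a).2.1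
      hasDerivAt_X_label := hXa
      hasDerivAt_V_label := fun t a => (hφa t a).snd.fst
      hasDerivAt_E_label := fun t a => hn₀ a ▸ ((hΦ _).comp a (hXa t a)).sub (hka t a)
      contDiff_X := hφ1.fst
      contDiff_V := hφ1.snd.fst
      contDiff_E := (hΦ1.comp hφ1.fst).sub hφ1.snd.snd }

theorem exists_lagrangianFlow {B L : NNReal} (hB : ∀ x, |γ x| ≤ B) (hL : LipschitzWith L γ)
    (hV₀ : ContDiff ℝ 1 V₀) (hE₀ : ContDiff ℝ 1 E₀) :
    ∃ X V E J P, LagrangianFlow γ V₀ E₀ X V E J P := by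
  set Φ : ℝ → ℝ := fun x => ∫ s in (0)..x, γ s
  have hΦ : ∀ x, HasDerivAt Φ (γ x) x := fun x =>
    (hL.continuous.integral_hasStrictDerivAt 0 x).hasDerivAt
  have hK := lipschitzWith_characteristicField hΦ hB
  have hL' := lipschitzWith_characteristicFieldDeriv hL
  obtain ⟨φ, hφ⟩ := exists_isGlobalFlow hK
  obtain ⟨A, hA⟩ :=
    hφ.exists_isVariationalFlow (norm_characteristicFieldDeriv_le hB) hL'.continuous
  exact ⟨_, _, _, _, _, hA.lagrangianFlow hφ hΦ hK hL' hL.continuous hV₀ hE₀ rfl rfl⟩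

end LagrangianFlow

section Oscillator

lemma apply_le_of_mul_deriv_nonneg {f f' : ℝ → ℝ} {p : ℝ} (hf : ∀ s, HasDerivAt f (f' s) s)
    (hp : ∀ s, 0 ≤ f' s * (s - p)) (x : ℝ) : f p ≤ f x := by
  have hfc : Continuous f := continuous_iff_continuousAt.2 fun s => (hf s).continuousAt
  rcases le_total p x with hx | hx
  · refine monotoneOn_of_deriv_nonneg (convex_Ici p) hfc.continuousOn
      (fun s _ => (hf s).differentiableAt.differentiableWithinAt) (fun s hs => ?_)
      self_mem_Ici hx hx
    rw [interior_Ici, mem_Ioi] at hs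
    rw [(hf s).deriv]
    exact nonneg_of_mul_nonneg_left (hp s) (sub_pos.2 hs)
  · refine antitoneOn_of_deriv_nonpos (convex_Iic p) hfc.continuousOn
      (fun s _ => (hf s).differentiableAt.differentiableWithinAt) (fun s hs => ?_)
      hx self_mem_Iic hx
    rw [interior_Iic, mem_Iio] at hs
    rw [(hf s).deriv]
    exact nonpos_of_mul_nonneg_left (hp s) (sub_neg.2 hs)

lemma is_const_of_hasDerivAt_zero {f : ℝ → ℝ} (hf : ∀ t, HasDerivAt f 0 t) (s t : ℝ) :
    f s = f t :=
  is_const_of_deriv_eq_zero (fun t => (hf t).differentiableAt) (fun t => (hf t).deriv) s t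

variable {h γ : ℝ → ℝ} {c₀ c₁ : ℝ}

lemma mul_sub_le_sub_of_le_deriv (hh : ∀ s, HasDerivAt h (γ s) s) (hγ₀ : ∀ s, c₀ ≤ γ s)
    {x y : ℝ} (hxy : x ≤ y) : c₀ * (y - x) ≤ h y - h x :=
  mul_sub_le_image_sub_of_le_deriv (fun s => (hh s).differentiableAt)
    (fun s => (hh s).deriv ▸ hγ₀ s) hxy

lemma mul_abs_sub_le_abs_sub_of_le_deriv (hh : ∀ s, HasDerivAt h (γ s) s)
    (hγ₀ : ∀ s, c₀ ≤ γ s) (x y : ℝ) : c₀ * |y - x| ≤ |h y - h x| := by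
  rcases le_total x y with hxy | hxy
  · rw [abs_of_nonneg (sub_nonneg.2 hxy)]
    exact (mul_sub_le_sub_of_le_deriv hh hγ₀ hxy).trans (le_abs_self _)
  · rw [abs_sub_comm, abs_sub_comm (h y), abs_of_nonneg (sub_nonneg.2 hxy)]
    exact (mul_sub_le_sub_of_le_deriv hh hγ₀ hxy).trans (le_abs_self _)

lemma exists_eq_zero_of_pos_le_deriv (hc₀ : 0 < c₀) (hh : ∀ s, HasDerivAt h (γ s) s)
    (hγ₀ : ∀ s, c₀ ≤ γ s) : ∃ p, h p = 0 := by
  have hhc : Continuous h := continuous_iff_continuousAt.2 fun s => (hh s).continuousAt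
  have hq : 0 ≤ |h 0| / c₀ := by positivity
  have hq' : c₀ * (|h 0| / c₀) = |h 0| := mul_div_cancel₀ _ hc₀.ne'
  refine mem_range_of_exists_le_of_exists_ge hhc ⟨-(|h 0| / c₀), ?_⟩ ⟨|h 0| / c₀, ?_⟩
  · have := mul_sub_le_sub_of_le_deriv hh hγ₀ (neg_nonpos.2 hq)
    linarith [le_abs_self (h 0)]
  · have := mul_sub_le_sub_of_le_deriv hh hγ₀ hq
    linarith [neg_abs_le (h 0)]

/-- `H` is a potential of the restoring force `-h` whose value at the equilibrium is `0`; for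
`c₀ ≤ h' ≤ c₁` it is comparable with `h ^ 2`, which is how this normalization is encoded. -/
structure IsPotential (h : ℝ → ℝ) (c₀ c₁ : ℝ) (H : ℝ → ℝ) : Prop where
  hasDerivAt : ∀ s, HasDerivAt H (h s) s
  le_sq : ∀ s, 2 * c₀ * H s ≤ h s ^ 2
  sq_le : ∀ s, h s ^ 2 ≤ 2 * c₁ * H s

lemma exists_isPotential (hc₀ : 0 < c₀) (hh : ∀ s, HasDerivAt h (γ s) s)
    (hγ₀ : ∀ s, c₀ ≤ γ s) (hγ₁ : ∀ s, γ s ≤ c₁) : ∃ H, IsPotential h c₀ c₁ H := by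
  have hhc : Continuous h := continuous_iff_continuousAt.2 fun s => (hh s).continuousAt
  obtain ⟨p, hp⟩ := exists_eq_zero_of_pos_le_deriv hc₀ hh hγ₀
  have hH : ∀ s, HasDerivAt (fun s => ∫ r in p..s, h r) (h s) s := fun s =>
    (hhc.integral_hasStrictDerivAt p s).hasDerivAt
  have hsq : ∀ s, HasDerivAt (fun s => h s ^ 2) (2 * γ s * h s) s := fun s =>
    ((hh s).pow 2).congr_deriv (by norm_num; ring)
  have hmono : Monotone h := fun x y hxy => sub_nonneg.1 <|
    (mul_nonneg hc₀.le (sub_nonneg.2 hxy)).trans (mul_sub_le_sub_of_le_deriv hh hγ₀ hxy)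
  have hsign : ∀ s, 0 ≤ h s * (s - p) := fun s => by
    rcases le_total p s with hs | hs
    · exact mul_nonneg (hp ▸ hmono hs) (sub_nonneg.2 hs)
    · exact mul_nonneg_of_nonpos_of_nonpos (hp ▸ hmono hs) (sub_nonpos.2 hs)
  refine ⟨_, hH, fun s => ?_, fun s => ?_⟩
  · have := apply_le_of_mul_deriv_nonneg (fun s => (hsq s).sub ((hH s).const_mul (2 * c₀)))
      (fun s => by linarith [mul_nonneg (sub_nonneg.2 (hγ₀ s)) (hsign s)])
      (p := p) s
    simpa [hp] using this
  · have := apply_le_of_mul_deriv_nonneg (fun s => ((hH s).const_mul (2 * c₁)).sub (hsq s))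
      (fun s => by linarith [mul_nonneg (sub_nonneg.2 (hγ₁ s)) (hsign s)])
      (p := p) s
    simpa [hp] using this

variable {H x V : ℝ → ℝ}

lemma IsPotential.energy_eq (hH : IsPotential h c₀ c₁ H) (hx : ∀ t, HasDerivAt x (V t) t)
    (hV : ∀ t, HasDerivAt V (-h (x t)) t) (t : ℝ) :
    V t ^ 2 + 2 * H (x t) = V 0 ^ 2 + 2 * H (x 0) :=
  is_const_of_hasDerivAt_zero (f := fun t => V t ^ 2 + 2 * H (x t)) (fun t =>
    (((hV t).pow 2).add (((hH.hasDerivAt (x t)).comp t (hx t)).const_mul 2)).congr_deriv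
      (by norm_num; ring)) t 0

lemma IsPotential.nonneg (hH : IsPotential h c₀ c₁ H) (hc₁ : 0 < c₁) (s : ℝ) : 0 ≤ H s :=
  nonneg_of_mul_nonneg_right ((sq_nonneg _).trans (hH.sq_le s)) (by positivity)

lemma IsPotential.energy_pos (hH : IsPotential h c₀ c₁ H) (hc₁ : 0 < c₁) {s v : ℝ}
    (hne : (v, h s) ≠ (0, 0)) : 0 < v ^ 2 + 2 * H s := by
  have hH₀ := hH.nonneg hc₁ s
  by_contra! hle
  have hv : v ^ 2 = 0 := by linarith [sq_nonneg v]
  have hHs : H s = 0 := by linarith [sq_nonneg v]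
  have hhs : h s ^ 2 = 0 := le_antisymm (by simpa [hHs] using hH.sq_le s) (sq_nonneg _)
  exact hne (Prod.ext (pow_eq_zero_iff two_ne_zero |>.1 hv) (pow_eq_zero_iff two_ne_zero |>.1 hhs))

lemma IsPotential.sq_velocity_le (hH : IsPotential h c₀ c₁ H) (hc₁ : 0 < c₁)
    (hx : ∀ t, HasDerivAt x (V t) t) (hV : ∀ t, HasDerivAt V (-h (x t)) t) (t : ℝ) :
    V t ^ 2 ≤ V 0 ^ 2 + 2 * H (x 0) := by
  linarith [hH.energy_eq hx hV t, hH.nonneg hc₁ (x t)]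

lemma IsPotential.sq_force_le (hH : IsPotential h c₀ c₁ H) (hc₁ : 0 < c₁)
    (hx : ∀ t, HasDerivAt x (V t) t) (hV : ∀ t, HasDerivAt V (-h (x t)) t) (t : ℝ) :
    h (x t) ^ 2 ≤ c₁ * (V 0 ^ 2 + 2 * H (x 0)) := by
  rw [← hH.energy_eq hx hV t]
  linarith [hH.sq_le (x t), mul_nonneg hc₁.le (sq_nonneg (V t))]

lemma sq_oscillation_le (hc₀ : 0 < c₀) (hh : ∀ s, HasDerivAt h (γ s) s)
    (hγ₀ : ∀ s, c₀ ≤ γ s) (hγ₁ : ∀ s, γ s ≤ c₁) (hx : ∀ t, HasDerivAt x (V t) t)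
    (hV : ∀ t, HasDerivAt V (-h (x t)) t) (t : ℝ) :
    (x t - x 0) ^ 2 ≤ 4 * c₁ / c₀ ^ 3 * (c₀ * V 0 ^ 2 + h (x 0) ^ 2) := by
  have hc₁ : 0 < c₁ := hc₀.trans_le ((hγ₀ 0).trans (hγ₁ 0))
  obtain ⟨H, hH⟩ := exists_isPotential hc₀ hh hγ₀ hγ₁
  have hforce : (h (x t) - h (x 0)) ^ 2 ≤ 4 * (c₁ * (V 0 ^ 2 + 2 * H (x 0))) := by
    nlinarith [hH.sq_force_le hc₁ hx hV t, hH.sq_force_le hc₁ hx hV 0,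
      sq_nonneg (h (x t) + h (x 0))]
  have hslope : c₀ ^ 2 * (x t - x 0) ^ 2 ≤ (h (x t) - h (x 0)) ^ 2 := by
    rw [← mul_pow, sq_le_sq, abs_mul, abs_of_pos hc₀]
    exact mul_abs_sub_le_abs_sub_of_le_deriv hh hγ₀ _ _
  rw [div_mul_eq_mul_div, le_div_iff₀ (by positivity)]
  calc (x t - x 0) ^ 2 * c₀ ^ 3 = c₀ * (c₀ ^ 2 * (x t - x 0) ^ 2) := by ring
    _ ≤ c₀ * (4 * (c₁ * (V 0 ^ 2 + 2 * H (x 0)))) :=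
        mul_le_mul_of_nonneg_left (hslope.trans hforce) hc₀.le
    _ = 4 * c₁ * (c₀ * V 0 ^ 2 + 2 * c₀ * H (x 0)) := by ring
    _ ≤ 4 * c₁ * (c₀ * V 0 ^ 2 + h (x 0) ^ 2) := by gcongr; exact hH.le_sq _

lemma IsPotential.exists_hasDerivAt_cube_velocity (hH : IsPotential h c₀ c₁ H)
    (hx : ∀ t, HasDerivAt x (V t) t) (hV : ∀ t, HasDerivAt V (-h (x t)) t) :
    ∃ G : ℝ → ℝ, Continuous G ∧ ∀ t, HasDerivAt (fun t => G (x t)) (V t ^ 3) t := by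
  set e := V 0 ^ 2 + 2 * H (x 0) with he
  have hHc : Continuous H := continuous_iff_continuousAt.2 fun s => (hH.hasDerivAt s).continuousAt
  have hG : ∀ s, HasDerivAt (fun s => ∫ r in (0 : ℝ)..s, (e - 2 * H r)) (e - 2 * H s) s :=
    fun s => ((continuous_const.sub (continuous_const.mul hHc)).integral_hasStrictDerivAt
      0 s).hasDerivAt
  refine ⟨_, continuous_iff_continuousAt.2 fun s => (hG s).continuousAt, fun t => ?_⟩
  refine ((hG (x t)).comp t (hx t)).congr_deriv ?_
  rw [he, ← hH.energy_eq hx hV t]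
  ring

end Oscillator

section Degeneration

lemma abs_mul_le_of_abs_le {u v A B : ℝ} (hu : |u| ≤ A) (hv : |v| ≤ B) : |u * v| ≤ A * B := by
  simpa only [Real.norm_eq_abs] using norm_mul_le_of_le (a₁ := u) (a₂ := v) hu hv

lemma add_mul_sub_le_of_le_deriv {f f' : ℝ → ℝ} {t₀ η t : ℝ} (hf : ∀ t, HasDerivAt f (f' t) t)
    (hη : ∀ t, t₀ ≤ t → η ≤ f' t) (ht : t₀ ≤ t) : f t₀ + η * (t - t₀) ≤ f t := by
  have := (convex_Ici t₀).mul_sub_le_image_sub_of_le_deriv (f := f) (C := η)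
    (fun s _ => (hf s).continuousAt.continuousWithinAt)
    (fun s _ => (hf s).differentiableAt.differentiableWithinAt)
    (fun s hs => (hf s).deriv ▸ hη s (interior_subset hs)) t₀ self_mem_Ici t ht ht
  linarith

lemma exists_lt_of_le_deriv {f f' : ℝ → ℝ} {t₀ η : ℝ} (hη₀ : 0 < η)
    (hf : ∀ t, HasDerivAt f (f' t) t) (hη : ∀ t, t₀ ≤ t → η ≤ f' t) (C : ℝ) :
    ∃ t, t₀ ≤ t ∧ C < f t := by
  have hstep : 0 ≤ (|C - f t₀| + 1) / η := by positivity
  refine ⟨t₀ + (|C - f t₀| + 1) / η, by linarith, ?_⟩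
  have hgrowth := add_mul_sub_le_of_le_deriv hf hη (le_add_of_nonneg_right hstep)
  rw [add_sub_cancel_left, mul_div_cancel₀ _ hη₀.ne'] at hgrowth
  linarith [le_abs_self (C - f t₀)]

lemma exists_lt_of_deriv_le {f f' : ℝ → ℝ} {t₀ η : ℝ} (hη₀ : 0 < η)
    (hf : ∀ t, HasDerivAt f (f' t) t) (hη : ∀ t, t₀ ≤ t → f' t ≤ -η) (C : ℝ) :
    ∃ t, t₀ ≤ t ∧ f t < C := by
  obtain ⟨t, ht, hlt⟩ := exists_lt_of_le_deriv hη₀ (fun t => (hf t).neg)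
    (fun t ht => le_neg.2 (hη t ht)) (-C)
  exact ⟨t, ht, neg_lt_neg_iff.1 hlt⟩

/-- A bounded, nondegenerate oscillation `x' = V`, `V' = -E`, `E' = γ V` through a medium whose
density `γ` varies along the trajectory as `γ' = b V`. The primitive `W` of `V ^ 3` is bounded as
well, which expresses that `V ^ 3` has no drift. -/
structure BoundedOscillation (x V E γ b W : ℝ → ℝ) (c₀ δ B : ℝ) : Prop where
  hasDerivAt_x : ∀ t, HasDerivAt x (V t) t
  hasDerivAt_V : ∀ t, HasDerivAt V (-E t) t
  hasDerivAt_E : ∀ t, HasDerivAt E (γ t * V t) t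
  hasDerivAt_γ : ∀ t, HasDerivAt γ (b t * V t) t
  hasDerivAt_W : ∀ t, HasDerivAt W (V t ^ 3) t
  abs_x_le : ∀ t, |x t| ≤ B
  abs_V_le : ∀ t, |V t| ≤ B
  abs_E_le : ∀ t, |E t| ≤ B
  abs_b_le : ∀ t, |b t| ≤ B
  abs_W_le : ∀ t, |W t| ≤ B
  le_γ : ∀ t, c₀ ≤ γ t
  γ_le : ∀ t, γ t ≤ B
  le_sq_add_sq : ∀ t, δ ≤ γ t * V t ^ 2 + E t ^ 2
  pos_c₀ : 0 < c₀
  pos_δ : 0 < δ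

/-- `J` solves the forced variational equation `J'' = κ - γ J`, with `P = J'`. -/
structure IsForcedVariation (γ : ℝ → ℝ) (κ : ℝ) (J P : ℝ → ℝ) : Prop where
  hasDerivAt_J : ∀ t, HasDerivAt J (P t) t
  hasDerivAt_P : ∀ t, HasDerivAt P (κ - γ t * J t) t

/-- The Wronskian `f' V - f V'` of `f` with the velocity `V`, where `V' = -E`. -/
def velocityWronskian (V E f f' : ℝ → ℝ) (t : ℝ) : ℝ := f' t * V t + f t * E t

variable {x V E γ b W J P : ℝ → ℝ} {κ c₀ b₀ δ B : ℝ}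

lemma IsForcedVariation.exists_nonpos_of_nonpos (hJ : IsForcedVariation γ κ J P) (hκ : κ ≤ 0)
    (hc₀ : 0 < c₀) (hγ : ∀ t, c₀ ≤ γ t) : ∃ t, 0 ≤ t ∧ J t ≤ 0 := by
  by_contra! hpos
  have hP' : ∀ t, 0 ≤ t → κ - γ t * J t ≤ -(c₀ * J t) := fun t ht => by
    linarith [mul_le_mul_of_nonneg_right (hγ t) (hpos t ht).le]
  have hP : ∀ s, 0 ≤ s → 0 ≤ P s := by
    intro s hs
    by_contra! hneg
    have hPs : ∀ t, s ≤ t → P t ≤ -(-P s) := fun t ht => by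
      have := add_mul_sub_le_of_le_deriv (η := 0) (fun t => (hJ.hasDerivAt_P t).neg)
        (fun t ht => by linarith [hP' t (hs.trans ht), mul_pos hc₀ (hpos t (hs.trans ht))]) ht
      simp only [Pi.neg_apply] at this
      linarith
    obtain ⟨t, ht, hlt⟩ := exists_lt_of_deriv_le (neg_pos.2 hneg) hJ.hasDerivAt_J hPs 0
    exact hlt.not_gt (hpos t (hs.trans ht))
  have hJ₀ : ∀ t, 0 ≤ t → J 0 ≤ J t := fun t ht => by
    linarith [add_mul_sub_le_of_le_deriv hJ.hasDerivAt_J hP ht]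
  obtain ⟨t, ht, hlt⟩ := exists_lt_of_deriv_le (mul_pos hc₀ (hpos 0 le_rfl)) hJ.hasDerivAt_P
    (fun t ht => (hP' t ht).trans (neg_le_neg (mul_le_mul_of_nonneg_left (hJ₀ t ht) hc₀.le))) 0
  exact hlt.not_ge (hP t ht)

lemma IsForcedVariation.deriv_ne_zero_or_ne_zero (hJ : IsForcedVariation γ κ J P) {T : ℝ}
    (hT : 0 ≤ T) (hγ : ∀ t, 0 ≤ γ t) (hJ₀ : 0 < J 0) (hnonneg : ∀ t ∈ Icc 0 T, 0 ≤ J t)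
    (hJT : J T = 0) : P T ≠ 0 ∨ κ ≠ 0 := by
  by_contra! ⟨hPT, rfl⟩
  have hP : AntitoneOn P (Icc 0 T) := antitoneOn_of_deriv_nonpos (convex_Icc 0 T)
    (fun t _ => (hJ.hasDerivAt_P t).continuousAt.continuousWithinAt)
    (fun t _ => (hJ.hasDerivAt_P t).differentiableAt.differentiableWithinAt) fun t ht => by
      rw [(hJ.hasDerivAt_P t).deriv, zero_sub, neg_nonpos]
      exact mul_nonneg (hγ t) (hnonneg t (interior_subset ht))
  have hJmono : MonotoneOn J (Icc 0 T) := monotoneOn_of_deriv_nonneg (convex_Icc 0 T)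
    (fun t _ => (hJ.hasDerivAt_J t).continuousAt.continuousWithinAt)
    (fun t _ => (hJ.hasDerivAt_J t).differentiableAt.differentiableWithinAt) fun t ht => by
      rw [(hJ.hasDerivAt_J t).deriv, ← hPT]
      exact hP (interior_subset ht) (right_mem_Icc.2 hT) (interior_subset ht).2
  exact hJ₀.not_ge (hJT ▸ hJmono (left_mem_Icc.2 hT) (right_mem_Icc.2 hT) hT)

namespace BoundedOscillation

lemma neg (h : BoundedOscillation x V E γ b W c₀ δ B) :
    BoundedOscillation (-x) (-V) (-E) γ (-b) (-W) c₀ δ B where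
  hasDerivAt_x t := (h.hasDerivAt_x t).neg
  hasDerivAt_V t := (h.hasDerivAt_V t).neg
  hasDerivAt_E t := (h.hasDerivAt_E t).neg.congr_deriv (by simp)
  hasDerivAt_γ t := (h.hasDerivAt_γ t).congr_deriv (by simp)
  hasDerivAt_W t := (h.hasDerivAt_W t).neg.congr_deriv (by simp [Odd.neg_pow (by decide : Odd 3)])
  abs_x_le t := by simpa using h.abs_x_le t
  abs_V_le t := by simpa using h.abs_V_le t
  abs_E_le t := by simpa using h.abs_E_le t
  abs_b_le t := by simpa using h.abs_b_le t
  abs_W_le t := by simpa using h.abs_W_le t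
  le_γ := h.le_γ
  γ_le := h.γ_le
  le_sq_add_sq t := by simpa using h.le_sq_add_sq t
  pos_c₀ := h.pos_c₀
  pos_δ := h.pos_δ

lemma pos_B (h : BoundedOscillation x V E γ b W c₀ δ B) : 0 < B :=
  h.pos_c₀.trans_le ((h.le_γ 0).trans (h.γ_le 0))

lemma sq_V_le (h : BoundedOscillation x V E γ b W c₀ δ B) (t : ℝ) : V t ^ 2 ≤ B ^ 2 :=
  sq_le_sq' (abs_le.1 (h.abs_V_le t)).1 (abs_le.1 (h.abs_V_le t)).2

lemma abs_V_mul_E_le (h : BoundedOscillation x V E γ b W c₀ δ B) (t : ℝ) : |V t * E t| ≤ B * B :=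
  abs_mul_le_of_abs_le (h.abs_V_le t) (h.abs_E_le t)

lemma hasDerivAt_V_mul_E (h : BoundedOscillation x V E γ b W c₀ δ B) (t : ℝ) :
    HasDerivAt (fun t => V t * E t) (γ t * V t ^ 2 - E t ^ 2) t :=
  ((h.hasDerivAt_V t).mul (h.hasDerivAt_E t)).congr_deriv (by ring)

lemma exists_velocity_lt (h : BoundedOscillation x V E γ b W c₀ δ B) :
    ∃ η > 0, ∀ s, ∃ t, s ≤ t ∧ V t < -η := by
  have hB := h.pos_B
  have hδ := h.pos_δ
  refine ⟨δ / (4 * B ^ 2), by positivity, fun s => ?_⟩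
  set η := δ / (4 * B ^ 2) with hη
  have : 0 < η := by positivity
  have hδη : δ = 4 * B ^ 2 * η := by rw [hη]; field_simp
  by_contra! hV
  -- As long as `-η ≤ V ≤ B`, the derivative of `2 (B - η) E - V E` is at least `δ / 2`.
  have hderiv : ∀ t, s ≤ t →
      δ / 2 ≤ 2 * (B - η) * (γ t * V t) - (γ t * V t ^ 2 - E t ^ 2) := fun t ht => by
    have hVB : 0 ≤ (V t + η) * (B - V t) :=
      mul_nonneg (by linarith [hV t ht]) (sub_nonneg.2 (abs_le.1 (h.abs_V_le t)).2)
    have hγV := mul_nonneg (h.pos_c₀.le.trans (h.le_γ t)) hVB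
    have hγη : γ t * (B * η) ≤ B * (B * η) := by gcongr; exact h.γ_le t
    linarith [h.le_sq_add_sq t]
  obtain ⟨t, -, hlt⟩ := exists_lt_of_le_deriv (half_pos hδ)
    (fun t => ((h.hasDerivAt_E t).const_mul _).sub (h.hasDerivAt_V_mul_E t)) hderiv
    (|2 * (B - η)| * B + B * B)
  exact hlt.not_ge <| (le_abs_self _).trans <| (abs_sub _ _).trans <|
    add_le_add (abs_mul_le_of_abs_le le_rfl (h.abs_E_le t)) (h.abs_V_mul_E_le t)

lemma exists_le_velocity_pow_four (h : BoundedOscillation x V E γ b W c₀ δ B) :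
    ∃ a > 0, ∃ m, ∀ t, a + m * (γ t * V t ^ 2 - E t ^ 2) ≤ V t ^ 4 := by
  have hB := h.pos_B
  have hδ := h.pos_δ
  set a := δ / (2 * B) with ha
  have : 0 < a := by positivity
  have hδa : δ = 2 * B * a := by rw [ha]; field_simp
  refine ⟨a ^ 2, by positivity, a / B, fun t => ?_⟩
  have hγV : γ t * V t ^ 2 ≤ B * V t ^ 2 := by gcongr; exact h.γ_le t
  have hpart : γ t * V t ^ 2 - E t ^ 2 ≤ B * (2 * V t ^ 2 - 2 * a) := by
    linarith [h.le_sq_add_sq t]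
  calc a ^ 2 + a / B * (γ t * V t ^ 2 - E t ^ 2)
      ≤ a ^ 2 + a / B * (B * (2 * V t ^ 2 - 2 * a)) := by gcongr
    _ = V t ^ 4 - (V t ^ 2 - a) ^ 2 := by field_simp; ring
    _ ≤ V t ^ 4 := sub_le_self _ (sq_nonneg _)

lemma hasDerivAt_velocityWronskian (h : BoundedOscillation x V E γ b W c₀ δ B)
    (hJ : IsForcedVariation γ κ J P) (t : ℝ) :
    HasDerivAt (velocityWronskian V E J P) (κ * V t) t :=
  (((hJ.hasDerivAt_P t).mul (h.hasDerivAt_V t)).add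
    ((hJ.hasDerivAt_J t).mul (h.hasDerivAt_E t))).congr_deriv (by ring)

lemma hasDerivAt_velocityWronskian_deriv (h : BoundedOscillation x V E γ b W c₀ δ B)
    (hJ : IsForcedVariation γ κ J P) (t : ℝ) :
    HasDerivAt (velocityWronskian V E P fun t => κ - γ t * J t) (-(b t * J t * V t ^ 2)) t :=
  (((((h.hasDerivAt_γ t).mul (hJ.hasDerivAt_J t)).const_sub κ).mul (h.hasDerivAt_V t)).add
    ((hJ.hasDerivAt_P t).mul (h.hasDerivAt_E t))).congr_deriv
      (by simp only [Pi.mul_apply]; ring)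

lemma exists_abs_velocityWronskian_le (h : BoundedOscillation x V E γ b W c₀ δ B)
    (hJ : IsForcedVariation γ κ J P) : ∃ C, ∀ t, |velocityWronskian V E J P t| ≤ C := by
  set N := velocityWronskian V E J P
  have hconst : ∀ t, N t - κ * x t = N 0 - κ * x 0 := fun t =>
    is_const_of_hasDerivAt_zero (f := fun t => N t - κ * x t) (fun t =>
      ((h.hasDerivAt_velocityWronskian hJ t).sub ((h.hasDerivAt_x t).const_mul κ)).congr_deriv
        (sub_self _)) t 0
  refine ⟨|N 0 - κ * x 0| + |κ| * B, fun t => ?_⟩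
  rw [← sub_add_cancel (N t) (κ * x t), hconst t]
  exact (abs_add_le _ _).trans
    (add_le_add le_rfl (abs_mul_le_of_abs_le le_rfl (h.abs_x_le t)))

lemma antitoneOn_velocityWronskian_deriv (h : BoundedOscillation x V E γ b W c₀ δ B)
    (hJ : IsForcedVariation γ κ J P) (hb : ∀ t, 0 ≤ b t) (hpos : ∀ t, 0 ≤ t → 0 < J t) :
    AntitoneOn (velocityWronskian V E P fun t => κ - γ t * J t) (Ici 0) := by
  intro s hs t _ hst
  have := add_mul_sub_le_of_le_deriv (η := 0)
    (fun t => (h.hasDerivAt_velocityWronskian_deriv hJ t).neg) (fun t ht => by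
      rw [neg_neg]
      exact mul_nonneg (mul_nonneg (hb t) (hpos t (le_trans hs ht)).le) (sq_nonneg _)) hst
  simp only [Pi.neg_apply] at this
  linarith

lemma mul_sq_add_sq_eq (V E γ J P : ℝ → ℝ) (κ t : ℝ) :
    J t * (E t ^ 2 + γ t * V t ^ 2) = velocityWronskian V E J P t * E t + κ * V t ^ 2
      - velocityWronskian V E P (fun t => κ - γ t * J t) t * V t := by
  simp only [velocityWronskian]
  ring

lemma exists_le_velocityWronskian_deriv (h : BoundedOscillation x V E γ b W c₀ δ B)
    (hJ : IsForcedVariation γ κ J P) (hκ : 0 < κ) (hb : ∀ t, 0 ≤ b t)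
    (hpos : ∀ t, 0 ≤ t → 0 < J t) :
    ∃ L, ∀ t, 0 ≤ t → L ≤ velocityWronskian V E P (fun t => κ - γ t * J t) t := by
  have hB := h.pos_B
  obtain ⟨C, hC⟩ := h.exists_abs_velocityWronskian_le hJ
  obtain ⟨η, hη, hVη⟩ := h.exists_velocity_lt
  set M := velocityWronskian V E P fun t => κ - γ t * J t
  have hMV : ∀ t, 0 ≤ t → M t * V t ≤ C * B + κ * B ^ 2 := fun t ht => by
    have hsq : 0 ≤ J t * (E t ^ 2 + γ t * V t ^ 2) :=
      mul_nonneg (hpos t ht).le (by linarith [h.le_sq_add_sq t, h.pos_δ])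
    rw [mul_sq_add_sq_eq V E γ J P κ t] at hsq
    have hNE := (le_abs_self _).trans (abs_mul_le_of_abs_le (hC t) (h.abs_E_le t))
    linarith [mul_le_mul_of_nonneg_left (h.sq_V_le t) hκ.le]
  have hC₀ : 0 ≤ C := (abs_nonneg _).trans (hC 0)
  refine ⟨-((C * B + κ * B ^ 2) / η), fun s hs => ?_⟩
  by_contra! hMs
  obtain ⟨t, hst, hVt⟩ := hVη s
  have hMt := h.antitoneOn_velocityWronskian_deriv hJ hb hpos hs (hs.trans hst) hst
  have hlt : (C * B + κ * B ^ 2) / η * η < -M t * -V t :=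
    mul_lt_mul'' (by linarith) (by linarith) (by positivity) hη.le
  rw [div_mul_cancel₀ _ hη.ne', neg_mul_neg] at hlt
  exact hlt.not_ge (hMV t (hs.trans hst))

lemma exists_sq_add_sq_add_le_mul (h : BoundedOscillation x V E γ b W c₀ δ B) (hb₀ : 0 < b₀)
    (hb : ∀ t, b₀ ≤ b t) : ∃ A, ∀ t, E t ^ 2 + γ t * V t ^ 2 + b t * W t ≤ A * b t := by
  have hB := h.pos_B
  refine ⟨(B ^ 2 + B * B ^ 2 + B * B) / b₀, fun t => ?_⟩
  have hE : E t ^ 2 ≤ B ^ 2 := sq_le_sq' (abs_le.1 (h.abs_E_le t)).1 (abs_le.1 (h.abs_E_le t)).2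
  have hγV : γ t * V t ^ 2 ≤ B * B ^ 2 :=
    mul_le_mul (h.γ_le t) (h.sq_V_le t) (sq_nonneg _) hB.le
  have hbW := (le_abs_self _).trans (abs_mul_le_of_abs_le (h.abs_b_le t) (h.abs_W_le t))
  calc E t ^ 2 + γ t * V t ^ 2 + b t * W t ≤ B ^ 2 + B * B ^ 2 + B * B := by linarith
    _ = (B ^ 2 + B * B ^ 2 + B * B) / b₀ * b₀ := (div_mul_cancel₀ _ hb₀.ne').symm
    _ ≤ (B ^ 2 + B * B ^ 2 + B * B) / b₀ * b t := by gcongr; exact hb t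

/-- Since `b` is bounded away from zero, the last term is nonnegative for large `A` as long as
`J ≥ 0`, and the functional then grows at least like the integral of `4 κ V ^ 4 / 3`. -/
lemma hasDerivAt_velocityWronskian_functional (h : BoundedOscillation x V E γ b W c₀ δ B)
    (hJ : IsForcedVariation γ κ J P) (A t : ℝ) :
    HasDerivAt (fun t => velocityWronskian V E J P t * V t ^ 3 / 3
        + velocityWronskian V E P (fun t => κ - γ t * J t) t * (W t - A))
      (4 / 3 * κ * V t ^ 4
        + J t * V t ^ 2 * (A * b t - (E t ^ 2 + γ t * V t ^ 2 + b t * W t))) t := by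
  refine ((((h.hasDerivAt_velocityWronskian hJ t).mul ((h.hasDerivAt_V t).pow 3)).div_const 3).add
    ((h.hasDerivAt_velocityWronskian_deriv hJ t).mul
      ((h.hasDerivAt_W t).sub_const A))).congr_deriv ?_
  norm_num
  linear_combination V t ^ 2 * mul_sq_add_sq_eq V E γ J P κ t

lemma exists_nonpos_of_pos (h : BoundedOscillation x V E γ b W c₀ δ B)
    (hJ : IsForcedVariation γ κ J P) (hκ : 0 < κ) (hb₀ : 0 < b₀) (hb : ∀ t, b₀ ≤ b t) :
    ∃ t, 0 ≤ t ∧ J t ≤ 0 := by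
  by_contra! hpos
  have hb' : ∀ t, 0 ≤ b t := fun t => hb₀.le.trans (hb t)
  obtain ⟨C, hC⟩ := h.exists_abs_velocityWronskian_le hJ
  obtain ⟨L, hL⟩ := h.exists_le_velocityWronskian_deriv hJ hκ hb' hpos
  obtain ⟨a, ha, m, hVa⟩ := h.exists_le_velocity_pow_four
  obtain ⟨A, hA⟩ := h.exists_sq_add_sq_add_le_mul hb₀ hb
  have hM := h.antitoneOn_velocityWronskian_deriv hJ hb' hpos
  have hF := h.hasDerivAt_velocityWronskian_functional hJ A
  set N := velocityWronskian V E J P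
  set M := velocityWronskian V E P fun t => κ - γ t * J t
  have hgrowth : ∀ t, 0 ≤ t → 4 / 3 * κ * a ≤ 4 / 3 * κ * V t ^ 4
      + J t * V t ^ 2 * (A * b t - (E t ^ 2 + γ t * V t ^ 2 + b t * W t))
      - 4 / 3 * κ * m * (γ t * V t ^ 2 - E t ^ 2) := fun t ht => by
    have hV := mul_le_mul_of_nonneg_left (hVa t) (by positivity : 0 ≤ 4 / 3 * κ)
    have hJV := mul_nonneg (mul_nonneg (hpos t ht).le (sq_nonneg (V t))) (sub_nonneg.2 (hA t))
    linarith
  obtain ⟨t, ht, hlt⟩ := exists_lt_of_le_deriv (by positivity) (fun t =>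
    (hF t).sub ((h.hasDerivAt_V_mul_E t).const_mul (4 / 3 * κ * m))) hgrowth
    (C * B ^ 3 / 3 + max |L| |M 0| * (B + |A|) + |4 / 3 * κ * m| * (B * B))
  refine hlt.not_ge <| (le_abs_self _).trans <| (abs_sub _ _).trans <| add_le_add
    ((abs_add_le _ _).trans <| add_le_add ?_ (abs_mul_le_of_abs_le ?_ ?_))
    (abs_mul_le_of_abs_le le_rfl (h.abs_V_mul_E_le t))
  · rw [abs_div, abs_of_pos (three_pos : (0 : ℝ) < 3)]
    gcongr
    exact abs_mul_le_of_abs_le (hC t) (by rw [abs_pow]; gcongr; exact h.abs_V_le t)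
  · exact abs_le_max_abs_abs (hL t ht) (hM self_mem_Ici ht ht)
  · exact (abs_sub _ _).trans (add_le_add (h.abs_W_le t) le_rfl)

lemma exists_nonpos (h : BoundedOscillation x V E γ b W c₀ δ B)
    (hJ : IsForcedVariation γ κ J P) (hb₀ : 0 < b₀) (hb : (∀ t, b₀ ≤ b t) ∨ ∀ t, b t ≤ -b₀) :
    ∃ t, 0 ≤ t ∧ J t ≤ 0 := by
  rcases le_or_gt κ 0 with hκ | hκ
  · exact hJ.exists_nonpos_of_nonpos hκ h.pos_c₀ h.le_γ
  · rcases hb with hb | hb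
    · exact h.exists_nonpos_of_pos hJ hκ hb₀ hb
    · exact h.neg.exists_nonpos_of_pos hJ hκ hb₀ fun t => le_neg.2 (hb t)

end BoundedOscillation

lemma exists_boundedOscillation {h γ b x V : ℝ → ℝ} {c₀ c₁ : ℝ} (hc₀ : 0 < c₀)
    (hh : ∀ s, HasDerivAt h (γ s) s) (hγ₀ : ∀ s, c₀ ≤ γ s) (hγ₁ : ∀ s, γ s ≤ c₁)
    (hb : Continuous b) (hx : ∀ t, HasDerivAt x (V t) t) (hV : ∀ t, HasDerivAt V (-h (x t)) t)
    (hγ : ∀ t, HasDerivAt γ (b (x t)) (x t)) (hne : (V 0, h (x 0)) ≠ (0, 0)) :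
    ∃ W δ B, BoundedOscillation x V (fun t => h (x t)) (fun t => γ (x t)) (fun t => b (x t)) W
      c₀ δ B := by
  have hc₁ : 0 < c₁ := hc₀.trans_le ((hγ₀ 0).trans (hγ₁ 0))
  have hhc : Continuous h := continuous_iff_continuousAt.2 fun s => (hh s).continuousAt
  obtain ⟨H, hH⟩ := exists_isPotential hc₀ hh hγ₀ hγ₁
  obtain ⟨G, hGc, hG⟩ := hH.exists_hasDerivAt_cube_velocity hx hV
  set e := V 0 ^ 2 + 2 * H (x 0)
  set R := √(4 * c₁ / c₀ ^ 3 * (c₀ * V 0 ^ 2 + h (x 0) ^ 2))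
  have hxR : ∀ t, x t ∈ Icc (x 0 - R) (x 0 + R) := fun t =>
    mem_Icc_iff_abs_le.1 <| (abs_sub_comm _ _).trans_le <|
      Real.abs_le_sqrt (sq_oscillation_le hc₀ hh hγ₀ hγ₁ hx hV t)
  obtain ⟨B, hB⟩ := isCompact_Icc.exists_bound_of_continuousOn (s := Icc (x 0 - R) (x 0 + R))
    (f := fun s => (s, h s, b s, G s)) (by fun_prop)
  simp only [norm_prod_le_iff, Real.norm_eq_abs] at hB
  have hBB : B ≤ max (max B c₁) √e := (le_max_left _ _).trans (le_max_left _ _)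
  refine ⟨fun t => G (x t), c₀ * e, max (max B c₁) √e,
    { hasDerivAt_x := hx
      hasDerivAt_V := hV
      hasDerivAt_E := fun t => (hh (x t)).comp t (hx t)
      hasDerivAt_γ := fun t => (hγ t).comp t (hx t)
      hasDerivAt_W := hG
      abs_x_le := fun t => (hB _ (hxR t)).1.trans hBB
      abs_V_le := fun t =>
        (Real.abs_le_sqrt (hH.sq_velocity_le hc₁ hx hV t)).trans (le_max_right _ _)
      abs_E_le := fun t => (hB _ (hxR t)).2.1.trans hBB
      abs_b_le := fun t => (hB _ (hxR t)).2.2.1.trans hBB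
      abs_W_le := fun t => (hB _ (hxR t)).2.2.2.trans hBB
      le_γ := fun t => hγ₀ (x t)
      γ_le := fun t => (hγ₁ (x t)).trans ((le_max_right _ _).trans (le_max_left _ _))
      le_sq_add_sq := fun t => ?_
      pos_c₀ := hc₀
      pos_δ := mul_pos hc₀ (hH.energy_pos hc₁ hne) }⟩
  calc c₀ * e = c₀ * V t ^ 2 + 2 * c₀ * H (x t) := by
        linear_combination (-c₀) * hH.energy_eq hx hV t
    _ ≤ γ (x t) * V t ^ 2 + h (x t) ^ 2 := by gcongr; exacts [hγ₀ _, hH.le_sq _]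

lemma exists_first_zero {f : ℝ → ℝ} (hf : Continuous f) (h₀ : 0 < f 0)
    (h : ∃ t, 0 ≤ t ∧ f t ≤ 0) : ∃ T > 0, f T = 0 ∧ ∀ t ∈ Ico 0 T, 0 < f t := by
  set S : Set ℝ := {t | 0 ≤ t ∧ f t ≤ 0}
  have hS : IsClosed S :=
    (isClosed_le continuous_const continuous_id).inter (isClosed_le hf continuous_const)
  have hbdd : BddBelow S := ⟨0, fun t ht => ht.1⟩
  have hmem : sInf S ∈ S := hS.csInf_mem h hbdd
  have hlt : ∀ t ∈ Ico 0 (sInf S), 0 < f t := fun t ht => by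
    by_contra! hle
    exact (csInf_le hbdd ⟨ht.1, hle⟩).not_gt ht.2
  have hpos : 0 < sInf S := hmem.1.lt_of_ne fun h => hmem.2.not_gt (h ▸ h₀)
  refine ⟨sInf S, hpos, le_antisymm hmem.2 ?_, hlt⟩
  refine ge_of_tendsto (hf.continuousWithinAt (s := Iio (sInf S))) ?_
  filter_upwards [Ioo_mem_nhdsLT hpos] with t ht using (hlt t ⟨ht.1.le, ht.2⟩).le

end Degeneration

section ClassicalSolution

lemma eqOn_Icc_of_hasDerivWithinAt_of_contDiff {F : Type*} [NormedAddCommGroup F] [NormedSpace ℝ F]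
    {f : F → F} (hf : ContDiff ℝ 1 f) {u w : ℝ → F} {T : ℝ}
    (hu : ∀ t ∈ Icc 0 T, HasDerivWithinAt u (f (u t)) (Ici 0) t)
    (hw : ∀ t ∈ Icc 0 T, HasDerivWithinAt w (f (w t)) (Ici 0) t) (h0 : u 0 = w 0) :
    EqOn u w (Icc 0 T) := by
  have hcont {y : ℝ → F} (hy : ∀ t ∈ Icc 0 T, HasDerivWithinAt y (f (y t)) (Ici 0) t) :
      ContinuousOn y (Icc 0 T) := fun t ht =>
    (hy t ht).continuousWithinAt.mono Icc_subset_Ici_self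
  have hright {y : ℝ → F} (hy : ∀ t ∈ Icc 0 T, HasDerivWithinAt y (f (y t)) (Ici 0) t) :
      ∀ t ∈ Ico 0 T, HasDerivWithinAt y (f (y t)) (Ici t) t := fun t ht =>
    (hy t (Ico_subset_Icc_self ht)).mono (Ici_subset_Ici.2 ht.1)
  obtain ⟨K, hK⟩ := LocallyLipschitzOn.exists_lipschitzOnWith_of_compact
    ((isCompact_Icc.image_of_continuousOn (hcont hu)).union
      (isCompact_Icc.image_of_continuousOn (hcont hw))) hf.locallyLipschitz.locallyLipschitzOn
  exact ODE_solution_unique_of_mem_Icc_right (v := fun _ => f) (fun _ _ => hK) (hcont hu)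
    (hright hu) (fun t ht => Or.inl (mem_image_of_mem u (Ico_subset_Icc_self ht))) (hcont hw)
    (hright hw) (fun t ht => Or.inr (mem_image_of_mem w (Ico_subset_Icc_self ht))) h0

lemma uniqueDiffOn_halfPlane : UniqueDiffOn ℝ {p : ℝ × ℝ | 0 ≤ p.1} := by
  convert (uniqueDiffOn_Ici (0 : ℝ)).prod (uniqueDiffOn_univ (𝕜 := ℝ) (E := ℝ)) using 1
  ext p
  simp

section HalfPlane

variable {F : ℝ → ℝ → ℝ} {U : Set (ℝ × ℝ)} {t x : ℝ}

lemma hasFDerivWithinAt_halfPlane (hU : IsOpen U)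
    (hF : ContDiffOn ℝ 1 (Function.uncurry F) (U ∩ {p | 0 ≤ p.1})) (ht : 0 ≤ t)
    (htx : (t, x) ∈ U) : HasFDerivWithinAt (Function.uncurry F)
      (fderivWithin ℝ (Function.uncurry F) (U ∩ {p | 0 ≤ p.1}) (t, x)) {p | 0 ≤ p.1} (t, x) := by
  have h := ((hF.differentiableOn one_ne_zero) (t, x) ⟨htx, ht⟩).hasFDerivWithinAt
  rw [inter_comm] at h ⊢
  exact (hasFDerivWithinAt_inter (hU.mem_nhds htx)).1 h

lemma hasDerivAt_space (hU : IsOpen U)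
    (hF : ContDiffOn ℝ 1 (Function.uncurry F) (U ∩ {p | 0 ≤ p.1})) (ht : 0 ≤ t)
    (htx : (t, x) ∈ U) : HasDerivAt (F t)
      (fderivWithin ℝ (Function.uncurry F) (U ∩ {p | 0 ≤ p.1}) (t, x) (0, 1)) x :=
  hasDerivWithinAt_univ.1 <|
    (hasFDerivWithinAt_halfPlane hU hF ht htx).comp_hasDerivWithinAt (s := univ) x
      (f := fun y => (t, y))
      ((hasDerivWithinAt_const x univ t).prodMk (hasDerivWithinAt_id x univ)) fun _ _ => ht

lemma hasDerivWithinAt_comp_curve (hU : IsOpen U)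
    (hF : ContDiffOn ℝ 1 (Function.uncurry F) (U ∩ {p | 0 ≤ p.1})) {y : ℝ → ℝ} {y' : ℝ}
    (ht : 0 ≤ t) (hty : (t, y t) ∈ U) (hy : HasDerivWithinAt y y' (Ici 0) t) :
    HasDerivWithinAt (fun s => F s (y s))
      (derivWithin (fun s => F s (y t)) (Ici 0) t + y' * deriv (F t) (y t)) (Ici 0) t := by
  have hcurve {z : ℝ → ℝ} {z' : ℝ} (hzy : z t = y t) (hz : HasDerivWithinAt z z' (Ici 0) t) :
      HasDerivWithinAt (fun s => F s (z s))
        (fderivWithin ℝ (Function.uncurry F) (U ∩ {p | 0 ≤ p.1}) (t, y t) (1, z')) (Ici 0) t := by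
    have hF' := hasFDerivWithinAt_halfPlane hU hF ht hty
    rw [← hzy] at hF' ⊢
    exact hF'.comp_hasDerivWithinAt t (f := fun s => (s, z s))
      ((hasDerivWithinAt_id t _).prodMk hz) fun _ hs => hs
  refine (hcurve rfl hy).congr_deriv ?_
  rw [(hasDerivAt_space hU hF ht hty).deriv,
    (hcurve (z := fun _ => y t) rfl (hasDerivWithinAt_const t _ _)).derivWithin
      (uniqueDiffOn_Ici 0 t ht),
    show ((1 : ℝ), y') = (1, 0) + y' • ((0 : ℝ), (1 : ℝ)) by ext <;> simp, map_add, map_smul,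
    smul_eq_mul]

lemma continuousOn_deriv_space (hU : IsOpen U)
    (hF : ContDiffOn ℝ 1 (Function.uncurry F) (U ∩ {p | 0 ≤ p.1})) {y : ℝ → ℝ} {T : ℝ}
    (hy : ContinuousOn y (Icc 0 T)) (hyU : ∀ s ∈ Icc 0 T, (s, y s) ∈ U) :
    ContinuousOn (fun s => deriv (F s) (y s)) (Icc 0 T) := by
  have hunique : UniqueDiffOn ℝ (U ∩ {p : ℝ × ℝ | 0 ≤ p.1}) :=
    inter_comm U _ ▸ uniqueDiffOn_halfPlane.inter hU
  refine ContinuousOn.congr ?_ fun s hs => (hasDerivAt_space hU hF hs.1 (hyU s hs)).deriv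
  exact ((hF.continuousOn_fderivWithin hunique le_rfl).comp (continuousOn_id.prodMk hy)
    fun s hs => ⟨hyU s hs, hs.1⟩).clm_apply continuousOn_const

end HalfPlane

section AlongCharacteristics

variable {c V₀ E₀ : ℝ → ℝ} {U : Set (ℝ × ℝ)} {V E : ℝ → ℝ → ℝ}

lemma IsClassicalSolution.hasDerivWithinAt_V (hs : IsClassicalSolution c V₀ E₀ U V E)
    (hU : IsOpen U) {y : ℝ → ℝ} {y' t : ℝ} (ht : 0 ≤ t) (hty : (t, y t) ∈ U)
    (hy : HasDerivWithinAt y y' (Ici 0) t) :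
    HasDerivWithinAt (fun s => V s (y s))
      (-E t (y t) + deriv (V t) (y t) * (y' - V t (y t))) (Ici 0) t :=
  (hasDerivWithinAt_comp_curve hU hs.contDiffOn_V ht hty hy).congr_deriv
    (by linear_combination hs.eq_V t (y t) ht hty)

lemma IsClassicalSolution.hasDerivWithinAt_E (hs : IsClassicalSolution c V₀ E₀ U V E)
    (hU : IsOpen U) {y : ℝ → ℝ} {y' t : ℝ} (ht : 0 ≤ t) (hty : (t, y t) ∈ U)
    (hy : HasDerivWithinAt y y' (Ici 0) t) :
    HasDerivWithinAt (fun s => E s (y s))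
      (c (y t) * V t (y t) + deriv (E t) (y t) * (y' - V t (y t))) (Ici 0) t :=
  (hasDerivWithinAt_comp_curve hU hs.contDiffOn_E ht hty hy).congr_deriv
    (by linear_combination hs.eq_E t (y t) ht hty)

lemma IsClassicalSolution.characteristic_eq (hs : IsClassicalSolution c V₀ E₀ U V E)
    (hU : IsOpen U) (hc : ContDiff ℝ 1 c) {x₀ T : ℝ} {x : ℝ → ℝ}
    (hx : IsCharacteristic V U x₀ T x) {y v e : ℝ → ℝ} (hy : ∀ t, HasDerivAt y (v t) t)
    (hv : ∀ t, HasDerivAt v (-e t) t) (he : ∀ t, HasDerivAt e (c (y t) * v t) t)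
    (hy0 : y 0 = x₀) (hv0 : v 0 = V₀ x₀) (he0 : e 0 = E₀ x₀) : EqOn x y (Ico 0 T) := by
  intro t ht
  have hmem (s) (hs : s ∈ Icc 0 t) : s ∈ Ico 0 T := ⟨hs.1, hs.2.trans_lt ht.2⟩
  have h0 : (0, x₀) ∈ U := hx.start ▸ hx.mem 0 ⟨le_rfl, ht.1.trans_lt ht.2⟩
  have hfield : ContDiff ℝ 1 fun p : ℝ × ℝ × ℝ => (p.2.1, -p.2.2, c p.1 * p.2.1) := by fun_prop
  have heq := eqOn_Icc_of_hasDerivWithinAt_of_contDiff (T := t) hfield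
    (u := fun s => (x s, V s (x s), E s (x s))) (w := fun s => (y s, v s, e s))
    (fun s hst => ?_)
    (fun s _ => ((hy s).prodMk ((hv s).prodMk (he s))).hasDerivWithinAt)
    (by simp [hx.start, hy0, hv0, he0, hs.initial_V x₀ h0, hs.initial_E x₀ h0])
  · exact congrArg Prod.fst (heq ⟨ht.1, le_rfl⟩)
  have hx' := hx.deriv_eq s (hmem s hst)
  have hV := hs.hasDerivWithinAt_V hU hst.1 (hx.mem s (hmem s hst)) hx'
  have hE := hs.hasDerivWithinAt_E hU hst.1 (hx.mem s (hmem s hst)) hx'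
  rw [sub_self, mul_zero, add_zero] at hV hE
  exact hx'.prodMk (hV.prodMk hE)

/-- The difference between the values of the solution along `y` and `(v, e)` solves a homogeneous
linear system, because the space derivatives of the solution are bounded along `y`. -/
lemma IsClassicalSolution.eq_along (hs : IsClassicalSolution c V₀ E₀ U V E) (hU : IsOpen U)
    (hc : Continuous c) {y v e : ℝ → ℝ} {T : ℝ} (hyU : ∀ s ∈ Icc 0 T, (s, y s) ∈ U)
    (hy : ∀ s ∈ Icc 0 T, HasDerivAt y (v s) s) (hv : ∀ s ∈ Icc 0 T, HasDerivAt v (-e s) s)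
    (he : ∀ s ∈ Icc 0 T, HasDerivAt e (c (y s) * v s) s) (hv0 : v 0 = V₀ (y 0))
    (he0 : e 0 = E₀ (y 0)) {t : ℝ} (ht : t ∈ Icc 0 T) : V t (y t) = v t ∧ E t (y t) = e t := by
  set w : ℝ → ℝ × ℝ := fun s => (V s (y s) - v s, E s (y s) - e s)
  set α : ℝ → ℝ := fun s => deriv (V s) (y s)
  set β : ℝ → ℝ := fun s => c (y s) - deriv (E s) (y s)
  have h0 : (0, y 0) ∈ U := hyU 0 ⟨le_rfl, ht.1.trans ht.2⟩
  have hw (s) (hst : s ∈ Icc 0 T) :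
      HasDerivWithinAt w (-(w s).2 - α s * (w s).1, β s * (w s).1) (Icc 0 T) s := by
    have hV := (hs.hasDerivWithinAt_V hU hst.1 (hyU s hst) (hy s hst).hasDerivWithinAt).sub
      (hv s hst).hasDerivWithinAt
    have hE := (hs.hasDerivWithinAt_E hU hst.1 (hyU s hst) (hy s hst).hasDerivWithinAt).sub
      (he s hst).hasDerivWithinAt
    exact ((hV.congr_deriv (by ring)).prodMk (hE.congr_deriv (by ring))).mono Icc_subset_Ici_self
  have hyc : ContinuousOn y (Icc 0 T) := fun s hs => (hy s hs).continuousAt.continuousWithinAt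
  obtain ⟨M, hM⟩ := isCompact_Icc.exists_bound_of_continuousOn (f := fun s => (α s, β s))
    ((continuousOn_deriv_space hU hs.contDiffOn_V hyc hyU).prodMk
      ((hc.comp_continuousOn hyc).sub (continuousOn_deriv_space hU hs.contDiffOn_E hyc hyU)))
  have hM0 : 0 ≤ M := (norm_nonneg _).trans (hM t ht)
  have hbound (s) (hst : s ∈ Icc 0 T) :
      ‖(-(w s).2 - α s * (w s).1, β s * (w s).1)‖ ≤ (1 + M) * ‖w s‖ + 0 := by
    obtain ⟨hα, hβ⟩ := norm_prod_le_iff.1 (hM s hst)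
    have h₁ : |α s * (w s).1| ≤ M * ‖w s‖ := abs_mul_le_of_abs_le hα (norm_fst_le (w s))
    have h₂ : |β s * (w s).1| ≤ M * ‖w s‖ := abs_mul_le_of_abs_le hβ (norm_fst_le (w s))
    have h₃ : |-(w s).2| ≤ ‖w s‖ := (abs_neg _).trans_le (norm_snd_le (w s))
    have h₄ := norm_nonneg (w s)
    exact norm_prod_le_iff.2 ⟨(abs_sub _ _).trans (by linarith), h₂.trans (by linarith)⟩
  have hzero := norm_le_of_norm_deriv_right_le (δ := 0) (by positivity) le_rfl hw
    (by simp [w, hv0, he0, hs.initial_V _ h0, hs.initial_E _ h0]) hbound ht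
  rw [add_zero, zero_mul, norm_le_zero_iff] at hzero
  exact ⟨sub_eq_zero.1 (congrArg Prod.fst hzero), sub_eq_zero.1 (congrArg Prod.snd hzero)⟩

variable {γ : ℝ → ℝ} {X v e J P : ℝ → ℝ → ℝ} {O : Set ℝ}

lemma IsClassicalSolution.eventually_eq_lagrangianFlow (hs : IsClassicalSolution c V₀ E₀ U V E)
    (hU : IsOpen U) (hc : Continuous c) (hfl : LagrangianFlow γ V₀ E₀ X v e J P) (hO : IsOpen O)
    (hγ : EqOn γ c O) {a t : ℝ} (ht : 0 ≤ t) (hXU : ∀ s ∈ Icc 0 t, (s, X s a) ∈ U)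
    (hXO : ∀ s ∈ Icc 0 t, X s a ∈ O) :
    ∀ᶠ b in 𝓝 a, V t (X t b) = v t b ∧ E t (X t b) = e t b := by
  have hev : ∀ᶠ b in 𝓝 a, ∀ s ∈ Icc 0 t, (s, X s b) ∈ U ∧ X s b ∈ O := by
    refine isCompact_Icc.eventually_forall_of_forall_eventually fun s hs => ?_
    have hX : Continuous fun z : ℝ × ℝ => X z.2 z.1 :=
      hfl.contDiff_X.continuous.comp continuous_swap
    exact ((continuous_snd.prodMk hX).continuousAt.eventually_mem
      (hU.mem_nhds (hXU s hs))).and (hX.continuousAt.eventually_mem (hO.mem_nhds (hXO s hs)))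
  filter_upwards [hev] with b hb
  refine hs.eq_along hU hc (y := fun s => X s b) (v := fun s => v s b) (e := fun s => e s b)
    (fun s hs => (hb s hs).1) (fun s _ => hfl.hasDerivAt_X s b) (fun s _ => hfl.hasDerivAt_V s b)
    (fun s hs => ?_) ?_ ?_ ⟨ht, le_rfl⟩
  · exact hγ (hb s hs).2 ▸ hfl.hasDerivAt_E s b
  · rw [hfl.V_zero, hfl.X_zero]
  · rw [hfl.E_zero, hfl.X_zero]

theorem IsClassicalSolution.deriv_mul_jacobian (hs : IsClassicalSolution c V₀ E₀ U V E)
    (hU : IsOpen U) (hc : Continuous c) (hfl : LagrangianFlow γ V₀ E₀ X v e J P) (hO : IsOpen O)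
    (hγ : EqOn γ c O) {a t : ℝ} (ht : 0 ≤ t) (hXU : ∀ s ∈ Icc 0 t, (s, X s a) ∈ U)
    (hXO : ∀ s ∈ Icc 0 t, X s a ∈ O) :
    deriv (V t) (X t a) * J t a = P t a ∧
      deriv (E t) (X t a) * J t a = γ (X t a) * J t a - initialDensity γ E₀ a := by
  have heq := hs.eventually_eq_lagrangianFlow hU hc hfl hO hγ ht hXU hXO
  have hta := hXU t ⟨ht, le_rfl⟩
  have hchain {F : ℝ → ℝ → ℝ} (hF : ContDiffOn ℝ 1 (Function.uncurry F) (U ∩ {p | 0 ≤ p.1})) :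
      HasDerivAt (fun b => F t (X t b)) (deriv (F t) (X t a) * J t a) a :=
    (hasDerivAt_space hU hF ht hta).differentiableAt.hasDerivAt.comp a
      (hfl.hasDerivAt_X_label t a)
  exact ⟨(hchain hs.contDiffOn_V).unique
      ((hfl.hasDerivAt_V_label t a).congr_of_eventuallyEq (heq.mono fun _ hb => hb.1)),
    (hchain hs.contDiffOn_E).unique
      ((hfl.hasDerivAt_E_label t a).congr_of_eventuallyEq (heq.mono fun _ hb => hb.2))⟩

end AlongCharacteristics

end ClassicalSolution

section EulerianFields

lemma isOpen_image_of_fderiv_isInvertible {F G : Type*} [NormedAddCommGroup F] [NormedSpace ℝ F]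
    [CompleteSpace F] [NormedAddCommGroup G] [NormedSpace ℝ G] {Ψ : F → G} (hΨ : ContDiff ℝ 1 Ψ)
    {W : Set F} (hW : IsOpen W) (hΨ' : ∀ p ∈ W, (fderiv ℝ Ψ p).IsInvertible) :
    IsOpen (Ψ '' W) := by
  rw [isOpen_iff_mem_nhds]
  rintro _ ⟨p, hp, rfl⟩
  obtain ⟨L, hL⟩ := hΨ' p hp
  have hstrict := hΨ.contDiffAt.hasStrictFDerivAt (x := p) one_ne_zero
  rw [← hL] at hstrict
  exact hstrict.map_nhds_eq_of_equiv ▸ image_mem_map (hW.mem_nhds hp)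

lemma contDiffAt_invFunOn_of_fderiv_isInvertible {F G : Type*} [NormedAddCommGroup F]
    [NormedSpace ℝ F] [CompleteSpace F] [NormedAddCommGroup G] [NormedSpace ℝ G] [Nonempty F]
    {Ψ : F → G} (hΨ : ContDiff ℝ 1 Ψ) {W : Set F} (hW : IsOpen W) (hinj : InjOn Ψ W) {p : F}
    (hp : p ∈ W) (hΨ' : (fderiv ℝ Ψ p).IsInvertible) :
    ContDiffAt ℝ 1 (Function.invFunOn Ψ W) (Ψ p) := by
  obtain ⟨L, hL⟩ := hΨ'
  have hderiv : HasFDerivAt Ψ (L : F →L[ℝ] G) p :=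
    hL ▸ (hΨ.differentiable one_ne_zero p).hasFDerivAt
  have hstrict := hΨ.contDiffAt.hasStrictFDerivAt' hderiv one_ne_zero
  refine (hΨ.contDiffAt.to_localInverse hderiv one_ne_zero).congr_of_eventuallyEq ?_
  filter_upwards [hstrict.eventually_right_inverse,
    hstrict.localInverse_tendsto.eventually (hW.mem_nhds hp)] with q hq hqW
  have hex : ∃ p ∈ W, Ψ p = q := ⟨_, hqW, hq⟩
  exact hinj (Function.invFunOn_mem hex) hqW ((Function.invFunOn_eq hex).trans hq.symm)

/-- The passage `(t, a) ↦ (t, X t a)` from Lagrangian to Eulerian coordinates. -/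
def flowMap (X : ℝ → ℝ → ℝ) (p : ℝ × ℝ) : ℝ × ℝ := (p.1, X p.1 p.2)

lemma mem_image_flowMap {X : ℝ → ℝ → ℝ} {W : Set (ℝ × ℝ)} {t x : ℝ} :
    (t, x) ∈ flowMap X '' W ↔ ∃ a, (t, a) ∈ W ∧ X t a = x := by
  simp [flowMap]

/-- The points `(t, a)` with `X t a ∈ O` such that the Jacobian is positive at time `t` at all
labels between `a₀` and `a`. On this set, unlike on the set `J > 0`, the flow map is injective. -/
def regularRegion (X J : ℝ → ℝ → ℝ) (O : Set ℝ) (a₀ : ℝ) : Set (ℝ × ℝ) :=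
  {p | (∀ b ∈ uIcc a₀ p.2, 0 < J p.1 b) ∧ X p.1 p.2 ∈ O}

/-- The function `F` of the Lagrangian coordinates expressed in Eulerian coordinates, through the
inverse of the flow map on `W`. -/
noncomputable def eulerianField (X : ℝ → ℝ → ℝ) (W : Set (ℝ × ℝ)) (F : ℝ → ℝ → ℝ) (t x : ℝ) : ℝ :=
  Function.uncurry F (Function.invFunOn (flowMap X) W (t, x))

variable {γ c V₀ E₀ : ℝ → ℝ} {X v e J P : ℝ → ℝ → ℝ} {O : Set ℝ} {a a₀ t T : ℝ}

lemma fderiv_uncurry_apply {F F₁ F₂ : ℝ → ℝ → ℝ} (hF : ContDiff ℝ 1 (Function.uncurry F))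
    (h₁ : ∀ t a, HasDerivAt (fun s => F s a) (F₁ t a) t)
    (h₂ : ∀ t a, HasDerivAt (F t) (F₂ t a) a) (p w : ℝ × ℝ) :
    fderiv ℝ (Function.uncurry F) p w = w.1 * F₁ p.1 p.2 + w.2 * F₂ p.1 p.2 := by
  have hd := (hF.differentiable one_ne_zero p).hasFDerivAt
  have htime : HasDerivAt (fun s => F s p.2) (fderiv ℝ (Function.uncurry F) p (1, 0)) p.1 :=
    hd.comp_hasDerivAt p.1 (f := fun s => (s, p.2))
      ((hasDerivAt_id p.1).prodMk (hasDerivAt_const p.1 p.2))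
  have hlabel : HasDerivAt (F p.1) (fderiv ℝ (Function.uncurry F) p (0, 1)) p.2 :=
    hd.comp_hasDerivAt p.2 (f := fun b => (p.1, b))
      ((hasDerivAt_const p.2 p.1).prodMk (hasDerivAt_id p.2))
  rw [(h₁ p.1 p.2).unique htime, (h₂ p.1 p.2).unique hlabel, ← smul_eq_mul, ← smul_eq_mul,
    ← map_smul, ← map_smul, ← map_add]
  simp

lemma LagrangianFlow.continuous_J (hfl : LagrangianFlow γ V₀ E₀ X v e J P) :
    Continuous (Function.uncurry J) := by
  refine ((hfl.contDiff_X.continuous_fderiv one_ne_zero).clm_apply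
    (continuous_const (y := ((0 : ℝ), (1 : ℝ))))).congr fun p => ?_
  rw [fderiv_uncurry_apply hfl.contDiff_X hfl.hasDerivAt_X hfl.hasDerivAt_X_label, zero_mul,
    zero_add, one_mul, Function.uncurry_def]

lemma LagrangianFlow.contDiff_flowMap (hfl : LagrangianFlow γ V₀ E₀ X v e J P) :
    ContDiff ℝ 1 (flowMap X) := contDiff_fst.prodMk hfl.contDiff_X

lemma LagrangianFlow.fderiv_flowMap_isInvertible (hfl : LagrangianFlow γ V₀ E₀ X v e J P)
    {p : ℝ × ℝ} (hJ : J p.1 p.2 ≠ 0) : (fderiv ℝ (flowMap X) p).IsInvertible := by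
  have hX := (hfl.contDiff_X.differentiable one_ne_zero p).hasFDerivAt
  have hd : fderiv ℝ (flowMap X) p
      = (ContinuousLinearMap.fst ℝ ℝ ℝ).prod (fderiv ℝ (Function.uncurry X) p) :=
    (hasFDerivAt_fst.prodMk hX).fderiv
  have hinj : Function.Injective (fderiv ℝ (flowMap X) p) := by
    rw [injective_iff_map_eq_zero, hd]
    rintro w hw
    simp only [ContinuousLinearMap.prod_apply, ContinuousLinearMap.coe_fst', Prod.mk_eq_zero,
      fderiv_uncurry_apply hfl.contDiff_X hfl.hasDerivAt_X hfl.hasDerivAt_X_label] at hw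
    have hsnd : w.2 * J p.1 p.2 = 0 := by simpa [hw.1] using hw.2
    exact Prod.ext hw.1 ((mul_eq_zero.1 hsnd).resolve_right hJ)
  exact ⟨(LinearEquiv.ofInjectiveEndo _ hinj).toContinuousLinearEquiv, rfl⟩

lemma LagrangianFlow.isOpen_regularRegion (hfl : LagrangianFlow γ V₀ E₀ X v e J P)
    (hO : IsOpen O) (a₀ : ℝ) : IsOpen (regularRegion X J O a₀) := by
  refine IsOpen.inter (isOpen_iff_eventually.2 fun p hp => ?_)
    (hO.preimage hfl.contDiff_X.continuous)
  simp only [← segment_eq_uIcc, segment_eq_image', forall_mem_image] at hp ⊢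
  refine isCompact_Icc.eventually_forall_of_forall_eventually fun s hs => ?_
  have hJ : Continuous fun z : (ℝ × ℝ) × ℝ => J z.1.1 (a₀ + z.2 • (z.1.2 - a₀)) :=
    hfl.continuous_J.comp (f := fun z : (ℝ × ℝ) × ℝ => (z.1.1, a₀ + z.2 • (z.1.2 - a₀)))
      (by fun_prop)
  exact hJ.continuousAt.eventually_const_lt (hp hs)

lemma LagrangianFlow.strictMonoOn_regularRegion (hfl : LagrangianFlow γ V₀ E₀ X v e J P) (t : ℝ) :
    StrictMonoOn (X t) {a | (t, a) ∈ regularRegion X J O a₀} := by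
  intro a ha b hb hab
  have hpos (s) (hs : s ∈ Icc a b) : 0 < J t s := by
    rcases le_total s a₀ with h | h
    · exact ha.1 s (mem_uIcc_of_ge hs.1 h)
    · exact hb.1 s (mem_uIcc_of_le h hs.2)
  refine strictMonoOn_of_deriv_pos (convex_Icc a b)
    (fun s _ => (hfl.hasDerivAt_X_label t s).continuousAt.continuousWithinAt) (fun s hs => ?_)
    (left_mem_Icc.2 hab.le) (right_mem_Icc.2 hab.le) hab
  rw [(hfl.hasDerivAt_X_label t s).deriv]
  exact hpos s (interior_subset hs)

lemma LagrangianFlow.injOn_flowMap (hfl : LagrangianFlow γ V₀ E₀ X v e J P) :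
    InjOn (flowMap X) (regularRegion X J O a₀) := by
  rintro ⟨t, a⟩ ha ⟨t', b⟩ hb heq
  obtain ⟨rfl, hX⟩ := Prod.mk.inj heq
  exact congrArg (Prod.mk t) ((hfl.strictMonoOn_regularRegion t).injOn ha hb hX)

lemma LagrangianFlow.eulerianField_apply (hfl : LagrangianFlow γ V₀ E₀ X v e J P)
    (F : ℝ → ℝ → ℝ) (hta : (t, a) ∈ regularRegion X J O a₀) :
    eulerianField X (regularRegion X J O a₀) F t (X t a) = F t a :=
  congrArg (Function.uncurry F) (hfl.injOn_flowMap.leftInvOn_invFunOn hta)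

lemma LagrangianFlow.isOpen_image_flowMap (hfl : LagrangianFlow γ V₀ E₀ X v e J P)
    (hO : IsOpen O) (a₀ : ℝ) : IsOpen (flowMap X '' regularRegion X J O a₀) :=
  isOpen_image_of_fderiv_isInvertible hfl.contDiff_flowMap (hfl.isOpen_regularRegion hO a₀)
    fun p hp => hfl.fderiv_flowMap_isInvertible (hp.1 p.2 right_mem_uIcc).ne'

lemma LagrangianFlow.contDiffOn_eulerianField (hfl : LagrangianFlow γ V₀ E₀ X v e J P)
    (hO : IsOpen O) {F : ℝ → ℝ → ℝ} (hF : ContDiff ℝ 1 (Function.uncurry F)) :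
    ContDiffOn ℝ 1 (Function.uncurry (eulerianField X (regularRegion X J O a₀) F))
      (flowMap X '' regularRegion X J O a₀) := by
  rintro _ ⟨p, hp, rfl⟩
  exact (hF.contDiffAt.comp _ (contDiffAt_invFunOn_of_fderiv_isInvertible hfl.contDiff_flowMap
    (hfl.isOpen_regularRegion hO a₀) hfl.injOn_flowMap hp
    (hfl.fderiv_flowMap_isInvertible (hp.1 p.2 right_mem_uIcc).ne'))).contDiffWithinAt

lemma LagrangianFlow.derivWithin_add_mul_deriv_eulerianField
    (hfl : LagrangianFlow γ V₀ E₀ X v e J P) (hO : IsOpen O) {F : ℝ → ℝ → ℝ}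
    (hF : ContDiff ℝ 1 (Function.uncurry F)) {f : ℝ} (ht : 0 ≤ t)
    (hta : (t, a) ∈ regularRegion X J O a₀) (hf : HasDerivAt (fun s => F s a) f t) :
    derivWithin (fun s => eulerianField X (regularRegion X J O a₀) F s (X t a)) (Ici 0) t
      + v t a * deriv (eulerianField X (regularRegion X J O a₀) F t) (X t a) = f := by
  set Q := eulerianField X (regularRegion X J O a₀) F
  have hmaterial := hasDerivWithinAt_comp_curve (F := Q) (y := fun s => X s a)
    (hfl.isOpen_image_flowMap hO a₀) ((hfl.contDiffOn_eulerianField hO hF).mono inter_subset_left)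
    ht ⟨(t, a), hta, rfl⟩ (hfl.hasDerivAt_X t a).hasDerivWithinAt
  have hnear : ∀ᶠ s in 𝓝 t, (s, a) ∈ regularRegion X J O a₀ :=
    (continuous_id.prodMk continuous_const).continuousAt.eventually_mem
      ((hfl.isOpen_regularRegion hO a₀).mem_nhds hta)
  have hQ : (fun s => Q s (X s a)) =ᶠ[𝓝 t] fun s => F s a :=
    hnear.mono fun s hs => hfl.eulerianField_apply F hs
  exact (uniqueDiffOn_Ici 0 t ht).eq_deriv _ hmaterial
    (hf.congr_of_eventuallyEq hQ).hasDerivWithinAt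

theorem LagrangianFlow.isClassicalSolution_eulerianField
    (hfl : LagrangianFlow γ V₀ E₀ X v e J P) (hO : IsOpen O) (hγ : EqOn γ c O) (a₀ : ℝ) :
    IsClassicalSolution c V₀ E₀ (flowMap X '' regularRegion X J O a₀)
      (eulerianField X (regularRegion X J O a₀) v)
      (eulerianField X (regularRegion X J O a₀) e) where
  contDiffOn_V := (hfl.contDiffOn_eulerianField hO hfl.contDiff_V).mono inter_subset_left
  contDiffOn_E := (hfl.contDiffOn_eulerianField hO hfl.contDiff_E).mono inter_subset_left
  eq_V := by
    intro t x ht hx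
    obtain ⟨a, hta, rfl⟩ := mem_image_flowMap.1 hx
    rw [hfl.eulerianField_apply v hta, hfl.eulerianField_apply e hta]
    exact hfl.derivWithin_add_mul_deriv_eulerianField hO hfl.contDiff_V ht hta
      (hfl.hasDerivAt_V t a)
  eq_E := by
    intro t x ht hx
    obtain ⟨a, hta, rfl⟩ := mem_image_flowMap.1 hx
    rw [hfl.eulerianField_apply v hta, ← hγ hta.2]
    exact hfl.derivWithin_add_mul_deriv_eulerianField hO hfl.contDiff_E ht hta
      (hfl.hasDerivAt_E t a)
  initial_V := by
    intro x hx
    obtain ⟨a, hta, rfl⟩ := mem_image_flowMap.1 hx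
    rw [hfl.eulerianField_apply v hta, hfl.V_zero, hfl.X_zero]
  initial_E := by
    intro x hx
    obtain ⟨a, hta, rfl⟩ := mem_image_flowMap.1 hx
    rw [hfl.eulerianField_apply e hta, hfl.E_zero, hfl.X_zero]

theorem LagrangianFlow.exists_isClassicalSolution (hfl : LagrangianFlow γ V₀ E₀ X v e J P)
    (hO : IsOpen O) (hγ : EqOn γ c O) (hJ : ∀ t ∈ Ico 0 T, 0 < J t a)
    (hXO : ∀ t ∈ Ico 0 T, X t a ∈ O) :
    ∃ (U : Set (ℝ × ℝ)) (V E : ℝ → ℝ → ℝ) (x : ℝ → ℝ), IsOpen U ∧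
      IsClassicalSolution c V₀ E₀ U V E ∧ IsCharacteristic V U a T x := by
  have hmem (t) (ht : t ∈ Ico 0 T) : (t, a) ∈ regularRegion X J O a :=
    ⟨by simpa using hJ t ht, hXO t ht⟩
  refine ⟨_, _, _, fun t => X t a, hfl.isOpen_image_flowMap hO a,
    hfl.isClassicalSolution_eulerianField hO hγ a, hfl.X_zero a,
    fun t ht => ⟨(t, a), hmem t ht, rfl⟩, fun t ht => ?_⟩
  rw [hfl.eulerianField_apply v (hmem t ht)]
  exact (hfl.hasDerivAt_X t a).hasDerivWithinAt

end EulerianFields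

section BlowUp

/-- `T` is the first zero of the Jacobian `J` along a characteristic with initial density `κ`, and
the numerators of `V_x = P / J` and `E_x = γ - κ / J` do not both vanish there. -/
structure IsFirstDegeneration (κ : ℝ) (J P : ℝ → ℝ) (T : ℝ) : Prop where
  pos : 0 < T
  jacobian_pos : ∀ t ∈ Ico 0 T, 0 < J t
  jacobian_eq_zero : J T = 0
  ne_zero_or_ne_zero : P T ≠ 0 ∨ κ ≠ 0

lemma IsForcedVariation.exists_isFirstDegeneration {γ J P : ℝ → ℝ} {κ : ℝ}
    (hJ : IsForcedVariation γ κ J P) (hγ : ∀ t, 0 ≤ γ t) (hJ₀ : 0 < J 0)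
    (h : ∃ t, 0 ≤ t ∧ J t ≤ 0) : ∃ T, IsFirstDegeneration κ J P T := by
  have hJc : Continuous J := continuous_iff_continuousAt.2 fun t => (hJ.hasDerivAt_J t).continuousAt
  obtain ⟨T, hT, hJT, hpos⟩ := exists_first_zero hJc hJ₀ h
  refine ⟨T, hT, hpos, hJT, hJ.deriv_ne_zero_or_ne_zero hT.le hγ hJ₀ (fun t ht => ?_) hJT⟩
  rcases ht.2.eq_or_lt with rfl | hlt
  · exact hJT.ge
  · exact (hpos t ⟨ht.1, hlt⟩).le

lemma tendsto_atTop_of_tendsto_mul_of_tendsto_zero {ι : Type*} {l : Filter ι} {f g : ι → ℝ} {y : ℝ}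
    (hy : 0 < y) (hfg : Tendsto (fun i => f i * g i) l (𝓝 y)) (hg : Tendsto g l (𝓝 0))
    (hpos : ∀ᶠ i in l, 0 < g i) : Tendsto f l atTop := by
  have hinv : Tendsto (fun i => (g i)⁻¹) l atTop :=
    tendsto_inv_nhdsGT_zero.comp (tendsto_nhdsWithin_iff.2 ⟨hg, hpos⟩)
  refine (hfg.pos_mul_atTop hy hinv).congr' (hpos.mono fun i hi => ?_)
  exact mul_inv_cancel_right₀ hi.ne' (f i)

section

variable {γ c V₀ E₀ : ℝ → ℝ} {X v e J P : ℝ → ℝ → ℝ} {O : Set ℝ} {a T : ℝ}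

lemma LagrangianFlow.isForcedVariation (hfl : LagrangianFlow γ V₀ E₀ X v e J P) (a : ℝ) :
    IsForcedVariation (fun t => γ (X t a)) (initialDensity γ E₀ a) (fun t => J t a)
      (fun t => P t a) :=
  ⟨fun t => hfl.hasDerivAt_J t a, fun t => hfl.hasDerivAt_P t a⟩

lemma LagrangianFlow.exists_primitive (hfl : LagrangianFlow γ V₀ E₀ X v e J P)
    (hγ : Continuous γ) (a : ℝ) :
    ∃ h : ℝ → ℝ, (∀ s, HasDerivAt h (γ s) s) ∧ ∀ t, e t a = h (X t a) := by
  set h : ℝ → ℝ := fun s => E₀ a + ∫ r in a..s, γ r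
  have hh (s : ℝ) : HasDerivAt h (γ s) s :=
    (hγ.integral_hasStrictDerivAt a s).hasDerivAt.const_add _
  have hconst := is_const_of_hasDerivAt_zero (f := fun t => e t a - h (X t a)) fun t =>
    ((hfl.hasDerivAt_E t a).sub ((hh _).comp t (hfl.hasDerivAt_X t a))).congr_deriv (sub_self _)
  refine ⟨h, hh, fun t => sub_eq_zero.1 ((hconst t 0).trans ?_)⟩
  simp [h, hfl.E_zero, hfl.X_zero]

lemma LagrangianFlow.mem_Ioo (hfl : LagrangianFlow γ V₀ E₀ X v e J P) (hγ : Continuous γ)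
    {c₀ c₁ r : ℝ} (hc₀ : 0 < c₀) (hγ₀ : ∀ s, c₀ ≤ γ s) (hγ₁ : ∀ s, γ s ≤ c₁) (hr : 0 < r)
    (hsmall : 4 * c₁ / c₀ ^ 3 * (c₀ + 1) * ‖(V₀ a, E₀ a)‖ ^ 2 < r ^ 2) (t : ℝ) :
    X t a ∈ Ioo (a - r) (a + r) := by
  obtain ⟨h, hh, he⟩ := hfl.exists_primitive hγ a
  have hc₁ : 0 < c₁ := hc₀.trans_le ((hγ₀ 0).trans (hγ₁ 0))
  have hX := sq_oscillation_le hc₀ hh hγ₀ hγ₁ (fun t => hfl.hasDerivAt_X t a)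
    (fun t => he t ▸ hfl.hasDerivAt_V t a) t
  rw [← he, hfl.X_zero, hfl.V_zero, hfl.E_zero] at hX
  have hV : V₀ a ^ 2 ≤ ‖(V₀ a, E₀ a)‖ ^ 2 := sq_le_sq.2
    ((norm_fst_le (V₀ a, E₀ a)).trans_eq (abs_of_nonneg (norm_nonneg _)).symm)
  have hE : E₀ a ^ 2 ≤ ‖(V₀ a, E₀ a)‖ ^ 2 := sq_le_sq.2
    ((norm_snd_le (V₀ a, E₀ a)).trans_eq (abs_of_nonneg (norm_nonneg _)).symm)
  suffices hlt : (X t a - a) ^ 2 < r ^ 2 by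
    have h := abs_lt_of_sq_lt_sq' hlt hr.le
    exact ⟨by linarith [h.1], by linarith [h.2]⟩
  calc (X t a - a) ^ 2 ≤ 4 * c₁ / c₀ ^ 3 * (c₀ * V₀ a ^ 2 + E₀ a ^ 2) := hX
    _ ≤ 4 * c₁ / c₀ ^ 3 * (c₀ * ‖(V₀ a, E₀ a)‖ ^ 2 + ‖(V₀ a, E₀ a)‖ ^ 2) := by gcongr
    _ = 4 * c₁ / c₀ ^ 3 * (c₀ + 1) * ‖(V₀ a, E₀ a)‖ ^ 2 := by ring
    _ < r ^ 2 := hsmall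

theorem LagrangianFlow.exists_isFirstDegeneration (hfl : LagrangianFlow γ V₀ E₀ X v e J P)
    (hγ : Continuous γ) {c₀ c₁ b₀ : ℝ} {b : ℝ → ℝ} (hc₀ : 0 < c₀) (hγ₀ : ∀ s, c₀ ≤ γ s)
    (hγ₁ : ∀ s, γ s ≤ c₁) (hb : Continuous b) (hγb : ∀ t, HasDerivAt γ (b (X t a)) (X t a))
    (hb₀ : 0 < b₀) (hbX : (∀ t, b₀ ≤ b (X t a)) ∨ ∀ t, b (X t a) ≤ -b₀)
    (hne : (V₀ a, E₀ a) ≠ (0, 0)) :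
    ∃ T, IsFirstDegeneration (initialDensity γ E₀ a) (fun t => J t a) (fun t => P t a) T := by
  obtain ⟨h, hh, he⟩ := hfl.exists_primitive hγ a
  obtain ⟨W, δ, B, hosc⟩ := exists_boundedOscillation hc₀ hh hγ₀ hγ₁ hb
    (fun t => hfl.hasDerivAt_X t a) (fun t => he t ▸ hfl.hasDerivAt_V t a) hγb
    (by rwa [← he, hfl.V_zero, hfl.E_zero])
  exact (hfl.isForcedVariation a).exists_isFirstDegeneration (fun t => hc₀.le.trans (hγ₀ _))
    (by simp [hfl.J_zero]) (hosc.exists_nonpos (hfl.isForcedVariation a) hb₀ hbX)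

lemma LagrangianFlow.characteristic_eq (hfl : LagrangianFlow γ V₀ E₀ X v e J P)
    {U : Set (ℝ × ℝ)} {V E : ℝ → ℝ → ℝ} {x : ℝ → ℝ} (hs : IsClassicalSolution c V₀ E₀ U V E)
    (hU : IsOpen U) (hc : ContDiff ℝ 1 c) (hγ : EqOn γ c O) (hXO : ∀ t, X t a ∈ O)
    (hx : IsCharacteristic V U a T x) : EqOn x (fun t => X t a) (Ico 0 T) :=
  hs.characteristic_eq hU hc hx (fun t => hfl.hasDerivAt_X t a) (fun t => hfl.hasDerivAt_V t a)
    (fun t => hγ (hXO t) ▸ hfl.hasDerivAt_E t a) (hfl.X_zero a) (hfl.V_zero a) (hfl.E_zero a)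

theorem LagrangianFlow.tendsto_abs_deriv_add_abs_deriv (hfl : LagrangianFlow γ V₀ E₀ X v e J P)
    (hγc : Continuous γ) (hc : ContDiff ℝ 1 c) (hO : IsOpen O) (hγ : EqOn γ c O)
    (hXO : ∀ t, X t a ∈ O)
    (hT : IsFirstDegeneration (initialDensity γ E₀ a) (fun t => J t a) (fun t => P t a) T)
    {U : Set (ℝ × ℝ)} {V E : ℝ → ℝ → ℝ} {x : ℝ → ℝ} (hU : IsOpen U)
    (hs : IsClassicalSolution c V₀ E₀ U V E) (hx : IsCharacteristic V U a T x) :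
    Tendsto (fun t => |deriv (V t) (x t)| + |deriv (E t) (x t)|) (𝓝[<] T) atTop := by
  have hxX := hfl.characteristic_eq hs hU hc hγ hXO hx
  have hIco : ∀ᶠ t in 𝓝[<] T, t ∈ Ico 0 T :=
    mem_of_superset (Ioo_mem_nhdsLT hT.pos) Ioo_subset_Ico_self
  have hXc : Continuous fun t => X t a :=
    continuous_iff_continuousAt.2 fun t => (hfl.hasDerivAt_X t a).continuousAt
  have hJc : Continuous fun t => J t a :=
    continuous_iff_continuousAt.2 fun t => (hfl.hasDerivAt_J t a).continuousAt
  have hPc : Continuous fun t => P t a :=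
    continuous_iff_continuousAt.2 fun t => (hfl.hasDerivAt_P t a).continuousAt
  have hJT : J T a = 0 := hT.jacobian_eq_zero
  set N : ℝ → ℝ := fun t => |P t a| + |γ (X t a) * J t a - initialDensity γ E₀ a|
  have hNT : 0 < N T := by
    simp only [N, hJT, mul_zero, zero_sub, abs_neg]
    rcases hT.ne_zero_or_ne_zero with h | h <;> positivity
  have hN (t) (ht : t ∈ Ico 0 T) : (|deriv (V t) (x t)| + |deriv (E t) (x t)|) * J t a = N t := by
    obtain ⟨hV, hE⟩ := hs.deriv_mul_jacobian hU hc.continuous hfl hO hγ ht.1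
      (fun s hs => by
        have hsT : s ∈ Ico 0 T := ⟨hs.1, hs.2.trans_lt ht.2⟩
        have hxs : x s = X s a := hxX hsT
        exact hxs ▸ hx.mem s hsT) (fun s _ => hXO s)
    simp only [N, ← hV, ← hE, hxX ht, abs_mul, abs_of_pos (hT.jacobian_pos t ht), add_mul]
  have hNc : Continuous N := by fun_prop
  refine tendsto_atTop_of_tendsto_mul_of_tendsto_zero hNT
    (hNc.continuousWithinAt.tendsto.congr' (hIco.mono fun t ht => (hN t ht).symm)) ?_
    (hIco.mono hT.jacobian_pos)
  exact hT.jacobian_eq_zero ▸ hJc.continuousWithinAt.tendsto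

theorem LagrangianFlow.blowsUpAlongCharacteristicAt (hfl : LagrangianFlow γ V₀ E₀ X v e J P)
    (hγc : Continuous γ) (hc : ContDiff ℝ 1 c) (hO : IsOpen O) (hγ : EqOn γ c O)
    (hXO : ∀ t, X t a ∈ O)
    (hT : IsFirstDegeneration (initialDensity γ E₀ a) (fun t => J t a) (fun t => P t a) T) :
    BlowsUpAlongCharacteristicAt c V₀ E₀ a T :=
  ⟨hfl.exists_isClassicalSolution hO hγ hT.jacobian_pos fun t _ => hXO t,
    fun _ _ _ _ hU hs hx => hfl.tendsto_abs_deriv_add_abs_deriv hγc hc hO hγ hXO hT hU hs hx⟩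

theorem LagrangianFlow.le_of_isClassicalSolution (hfl : LagrangianFlow γ V₀ E₀ X v e J P)
    (hc : Continuous c) (hO : IsOpen O) (hγ : EqOn γ c O) (hXO : ∀ t, X t a ∈ O)
    (hT : IsFirstDegeneration (initialDensity γ E₀ a) (fun t => J t a) (fun t => P t a) T)
    {T' : ℝ} {V E : ℝ → ℝ → ℝ} (hs : IsClassicalSolution c V₀ E₀ (Iio T' ×ˢ univ) V E) :
    T' ≤ T := by
  by_contra! hlt
  obtain ⟨hV, hE⟩ := hs.deriv_mul_jacobian (isOpen_Iio.prod isOpen_univ) hc hfl hO hγ hT.pos.le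
    (fun s hs => ⟨hs.2.trans_lt hlt, mem_univ _⟩) (fun s _ => hXO s)
  have hJT : J T a = 0 := hT.jacobian_eq_zero
  rw [hJT, mul_zero] at hV hE
  rw [mul_zero, zero_sub, zero_eq_neg] at hE
  exact hT.ne_zero_or_ne_zero.elim (· hV.symm) (· hE)

end

end BlowUp

section Truncation

/-- The profile `γ` coincides with `c` near `x₀`, where `c'` is bounded away from zero, and has the
global bounds that make the flow of the profile globally defined. -/
structure IsTruncation (c : ℝ → ℝ) (x₀ r c₀ c₁ b₀ : ℝ) (L : NNReal) (γ : ℝ → ℝ) : Prop where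
  lipschitzWith : LipschitzWith L γ
  le_γ : ∀ x, c₀ ≤ γ x
  γ_le : ∀ x, γ x ≤ c₁
  eqOn : EqOn γ c (Ioo (x₀ - r) (x₀ + r))
  le_deriv_or_deriv_le : (∀ x ∈ Ioo (x₀ - r) (x₀ + r), b₀ ≤ deriv c x) ∨
    ∀ x ∈ Ioo (x₀ - r) (x₀ + r), deriv c x ≤ -b₀

lemma exists_eventually_le_or_le_neg {f : ℝ → ℝ} {x₀ : ℝ} (hf : ContinuousAt f x₀)
    (hne : f x₀ ≠ 0) :
    ∃ b₀ > 0, (∀ᶠ x in 𝓝 x₀, b₀ ≤ f x) ∨ ∀ᶠ x in 𝓝 x₀, f x ≤ -b₀ := by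
  refine ⟨|f x₀| / 2, by positivity, hne.symm.lt_or_gt.imp (fun h => ?_) fun h => ?_⟩
  · exact (hf.eventually_const_lt (by rw [abs_of_pos h]; linarith)).mono fun x hx => hx.le
  · exact (hf.eventually_lt_const (by rw [abs_of_neg h]; linarith)).mono fun x hx => hx.le

lemma exists_isTruncation {c : ℝ → ℝ} (hc : ContDiff ℝ 1 c) {x₀ : ℝ} (hcx₀ : 0 < c x₀)
    (hc' : deriv c x₀ ≠ 0) :
    ∃ r > 0, ∃ c₀ > 0, ∃ c₁, ∃ b₀ > 0, ∃ L γ, IsTruncation c x₀ r c₀ c₁ b₀ L γ := by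
  obtain ⟨b₀, hb₀, hb⟩ := exists_eventually_le_or_le_neg
    (hc.continuous_deriv le_rfl).continuousAt hc'
  have hbounds : ∀ᶠ x in 𝓝 x₀, c x ∈ Icc (c x₀ / 2) (2 * c x₀) :=
    hc.continuous.continuousAt.eventually_mem (Icc_mem_nhds (by linarith) (by linarith))
  obtain ⟨r, hr, hball⟩ : ∃ r > 0, (∀ x ∈ Icc (x₀ - r) (x₀ + r), c x ∈ Icc (c x₀ / 2) (2 * c x₀)) ∧
      ((∀ x ∈ Icc (x₀ - r) (x₀ + r), b₀ ≤ deriv c x) ∨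
        ∀ x ∈ Icc (x₀ - r) (x₀ + r), deriv c x ≤ -b₀) := by
    simp only [← Real.closedBall_eq_Icc]
    rcases hb with hb | hb <;>
      obtain ⟨r, hr, h⟩ := Metric.nhds_basis_closedBall.eventually_iff.1 (hbounds.and hb)
    · exact ⟨r, hr, fun x hx => (h hx).1, Or.inl fun x hx => (h hx).2⟩
    · exact ⟨r, hr, fun x hx => (h hx).1, Or.inr fun x hx => (h hx).2⟩
  have hle : x₀ - r ≤ x₀ + r := by linarith
  obtain ⟨L, hL⟩ := hc.contDiffOn.exists_lipschitzOnWith one_ne_zero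
    (convex_Icc (x₀ - r) (x₀ + r)) isCompact_Icc
  exact ⟨r, hr, c x₀ / 2, by positivity, 2 * c x₀, b₀, hb₀, L * 1,
    IccExtend hle ((Icc (x₀ - r) (x₀ + r)).domRestrict c),
    hL.to_restrict.comp (LipschitzWith.projIcc hle),
    fun x => (hball.1 _ (projIcc _ _ hle x).2).1, fun x => (hball.1 _ (projIcc _ _ hle x).2).2,
    fun x hx => IccExtend_of_mem hle _ (Ioo_subset_Icc_self hx),
    hball.2.imp (fun h x hx => h x (Ioo_subset_Icc_self hx))
      fun h x hx => h x (Ioo_subset_Icc_self hx)⟩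

lemma IsTruncation.hasDerivAt {c γ : ℝ → ℝ} {x₀ r c₀ c₁ b₀ x : ℝ} {L : NNReal}
    (h : IsTruncation c x₀ r c₀ c₁ b₀ L γ) (hc : ContDiff ℝ 1 c)
    (hx : x ∈ Ioo (x₀ - r) (x₀ + r)) : HasDerivAt γ (deriv c x) x :=
  ((hc.differentiable one_ne_zero) x).hasDerivAt.congr_of_eventuallyEq
    (eventually_of_mem (isOpen_Ioo.mem_nhds hx) h.eqOn)

lemma IsTruncation.exists_lagrangianFlow {c γ V₀ E₀ : ℝ → ℝ} {x₀ r c₀ c₁ b₀ : ℝ} {L : NNReal}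
    (h : IsTruncation c x₀ r c₀ c₁ b₀ L γ) (hc₀ : 0 < c₀) (hV₀ : ContDiff ℝ 1 V₀)
    (hE₀ : ContDiff ℝ 1 E₀) : ∃ X v e J P, LagrangianFlow γ V₀ E₀ X v e J P := by
  have hpos (x : ℝ) : 0 < γ x := hc₀.trans_le (h.le_γ x)
  refine EulerPoisson.exists_lagrangianFlow (B := ⟨c₁, (hpos 0).le.trans (h.γ_le 0)⟩) (fun x => ?_)
    h.lipschitzWith hV₀ hE₀
  exact (abs_of_pos (hpos x)).trans_le (h.γ_le x)

end Truncation

end EulerPoisson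

open EulerPoisson in
theorem mainTheorem4_general {c : ℝ → ℝ} (hc : ContDiff ℝ 1 c) {x₀ : ℝ} (hcx₀ : 0 < c x₀)
    (hc' : deriv c x₀ ≠ 0) :
    ∃ ε > 0, ∀ V₀ E₀ : ℝ → ℝ, ContDiff ℝ 1 V₀ → ContDiff ℝ 1 E₀ →
      (V₀ x₀, E₀ x₀) ≠ (0, 0) → ‖(V₀ x₀, E₀ x₀)‖ < ε →
      ∃ T > 0, BlowsUpAlongCharacteristicAt c V₀ E₀ x₀ T ∧
        ∀ (T' : ℝ) (V E : ℝ → ℝ → ℝ),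
          IsClassicalSolution c V₀ E₀ (Iio T' ×ˢ univ) V E → T' ≤ T := by
  obtain ⟨r, hr, c₀, hc₀, c₁, b₀, hb₀, L, γ, hγ⟩ := exists_isTruncation hc hcx₀ hc'
  have hγc : Continuous γ := hγ.lipschitzWith.continuous
  have hc₁ : 0 < c₁ := hc₀.trans_le ((hγ.le_γ 0).trans (hγ.γ_le 0))
  set K := 4 * c₁ / c₀ ^ 3 * (c₀ + 1)
  have hK : 0 < K := by positivity
  refine ⟨√(r ^ 2 / K), by positivity, fun V₀ E₀ hV₀ hE₀ hne hsmall => ?_⟩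
  rw [Real.lt_sqrt (norm_nonneg _), lt_div_iff₀' hK] at hsmall
  obtain ⟨X, v, e, J, P, hfl⟩ := hγ.exists_lagrangianFlow hc₀ hV₀ hE₀
  have hX (t : ℝ) : X t x₀ ∈ Ioo (x₀ - r) (x₀ + r) :=
    hfl.mem_Ioo hγc hc₀ hγ.le_γ hγ.γ_le hr hsmall t
  obtain ⟨T, hT⟩ := hfl.exists_isFirstDegeneration hγc hc₀ hγ.le_γ hγ.γ_le
    (hc.continuous_deriv le_rfl) (fun t => hγ.hasDerivAt hc (hX t)) hb₀
    (hγ.le_deriv_or_deriv_le.imp (fun h t => h _ (hX t)) fun h t => h _ (hX t)) hne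
  exact ⟨T, hT.pos, hfl.blowsUpAlongCharacteristicAt hγc hc isOpen_Ioo hγ.eqOn hX hT,
    fun _ _ _ hs => hfl.le_of_isClassicalSolution hc.continuous isOpen_Ioo hγ.eqOn hX hT hs⟩

theorem mainTheorem4 (c : ℝ → ℝ) (hc : ContDiff ℝ 2 c) (hc_pos : ∀ x, 0 < c x)
    (hc_nonconst : ∃ x y, c x ≠ c y) :
    (∃ x₀, deriv c x₀ ≠ 0) ∧
    ∀ x₀, deriv c x₀ ≠ 0 → ∃ ε > 0, ∀ V₀ E₀ : ℝ → ℝ, ContDiff ℝ 2 V₀ → ContDiff ℝ 2 E₀ →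
      (V₀ x₀, E₀ x₀) ≠ (0, 0) → ‖(V₀ x₀, E₀ x₀)‖ < ε →
      ∃ T > 0, EulerPoisson.BlowsUpAlongCharacteristicAt c V₀ E₀ x₀ T ∧
        ∀ (T' : ℝ) (V E : ℝ → ℝ → ℝ),
          EulerPoisson.IsClassicalSolution c V₀ E₀ (Iio T' ×ˢ univ) V E → T' ≤ T := by
  refine ⟨?_, fun x₀ hx₀ => ?_⟩
  · by_contra! h
    obtain ⟨x, y, hxy⟩ := hc_nonconst
    exact hxy (is_const_of_deriv_eq_zero (hc.differentiable two_ne_zero) h x y)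
  · obtain ⟨ε, hε, h⟩ := mainTheorem4_general (hc.of_le one_le_two) (hc_pos x₀) hx₀
    exact ⟨ε, hε, fun V₀ E₀ hV₀ hE₀ => h V₀ E₀ (hV₀.of_le one_le_two) (hE₀.of_le one_le_two)⟩
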